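/- Conventions. A graph is a connected metric graph without loops all of whose edges have length $1$; $[0,\infty)$ is the graph with vertex set $\mathbb N=\{0,1,2,\dots\}$. A geodesic metric space is $\delta$-hyperbolic if its geodesic triangles are $\delta$-slim. For a hyperbolic space $Y$, $\partial Y$ is its geodesic boundary (geodesic rays up to finite Hausdorff distance), $\partial^3Y$ is the set of triples of pairwise distinct points of $\partial Y$, and for $A\subseteq Y$ the limit set $\Lambda_Y(A)\subseteq\partial Y$ is the set of limits in $\partial Y$ of sequences in $A$. For a quasigeodesic ray $\gamma$, $\gamma(\infty)$ is the class of the geodesic rays at finite Hausdorff distance from $\gamma$. A $D$-barycenter of $(\xi_1,\xi_2,\xi_3)\in\partial^3Y$ is a point at distance at most $D$ from every geodesic line joining $\xi_a$ and $\xi_b$, for all $a\neq b$. Let $f:\mathbb N\to\mathbb N$ with $f(n)\to\infty$. An $f$-metric graph bundle $\pi:X\to[0,\infty)$ is a simplicial, surjective, $1$-Lipschitz map from a graph $X$ such that (1) for every $i\in\mathbb N$ the fiber $F_i=\pi^{-1}(i)$ is a connected subgraph, and its path metric $d_i$ satisfies $d_i(x,y)\le f(r)$ whenever $x,y\in F_i$,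 $r\in\mathbb N$ and $d_X(x,y)\le r$; (2) if $|i-j|=1$, every vertex of $F_i$ is joined by an edge of $X$ to a vertex of $F_j$. It has controlled hyperbolic fibers with parameters $\delta,L\ge 0$ if every $F_i$ is $\delta$-hyperbolic and the barycenter maps $\partial^3F_i\to F_i$ (sending a triple to a $D$-barycenter of it, with $D$ independent of $i$) are $L$-coarsely surjective, i.e. every point of $F_i$ is at distance at most $L$ from the image. For each $i$ let $\phi_i:F_i\to F_{i+1}$ be a natural quasiisometry: it sends each vertex to a vertex joined to it by an edge of $X$, and each interior point of an edge of $F_i$ to the image of an endpoint of that edge; it induces $\partial\phi_i:\partial F_i\to\partial F_{i+1}$, $\alpha(\infty)\mapsto(\phi_i\circ\alpha)(\infty)$. For $K\ge1$, a $K$-qi section is a map $\Sigma:[0,\infty)\to X$ with $\pi(\Sigma(i))=i$ for all $i\in\mathbb N$ and $\frac1K|s-t|-K\le d_X(\Sigma(s),\Sigma(t))\le K|s-t|+K$ for all $s,t$. It is good if there are $(\xi_{1,i},\xi_{2,i},\xi_{3,i})\in\partial^3F_i$, $i\in\mathbb N$, with $\partial\phi_i(\xi_{j,i})=\xi_{j,i+1}$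 for all $i$ and $j\in\{1,2,3\}$, such that $\Sigma(i)$ is a $K$-barycenter of $(\xi_{1,i},\xi_{2,i},\xi_{3,i})$ in $F_i$ for all $i$. **Proposition 4.15.** For every $\delta\ge0$ and $f:\mathbb N\to\mathbb N$ there is a constant $K=K(\delta,f)\ge1$ such that the following holds. Let $\pi:X\to[0,\infty)$ be an $f$-metric graph bundle with controlled hyperbolic fibers with parameters $\delta$ and some $L$, whose fibers (with their path metrics) are proper, and suppose that $X$ is hyperbolic. Then for any choice of natural quasiisometries $\phi_i$, every good $K$-qi section $\Sigma$ has a well-defined endpoint $\Sigma(\infty)\in\partial X$ and, as a set, $$\partial X=\Lambda_X(F_0)\cup\partial_{good}X,\qquad \partial_{good}X=\{\Sigma(\infty):\Sigma\text{ is a good }K\text{-qi section over }[0,\infty)\}.$$ -/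

import Mathlib

open scoped NNReal

universe u v

/-! ### Geodesics, hyperbolicity, quasi-isometric embeddings -/

section MetricNotions

variable {X : Type u} [MetricSpace X]

/-- `c` is a geodesic segment from `x` to `y`, parametrised by arc length on `[0, d(x, y)]` and
extended by the constant `y` afterwards, so that its image is `Set.range c`. -/
structure IsGeodesicSegment (c : ℝ≥0 → X) (x y : X) : Prop where
  source : c 0 = x
  isometric : ∀ s t : ℝ≥0, s ≤ nndist x y → t ≤ nndist x y → dist (c s) (c t) = dist s t
  target : ∀ t : ℝ≥0, nndist x y ≤ t → c t = y

/-- A `δ`-hyperbolic geodesic metric space: any two points are joined by a geodesic segment and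
all geodesic triangles are `δ`-slim. -/
structure IsHyperbolic (δ : ℝ) (X : Type u) [MetricSpace X] : Prop where
  geodesic : ∀ x y : X, ∃ c : ℝ≥0 → X, IsGeodesicSegment c x y
  slim : ∀ (x y z : X) (c₁ c₂ c₃ : ℝ≥0 → X),
    IsGeodesicSegment c₁ x y → IsGeodesicSegment c₂ y z → IsGeodesicSegment c₃ x z →
      ∀ p ∈ Set.range c₁, ∃ q ∈ Set.range c₂ ∪ Set.range c₃, dist p q ≤ δ

/-- A `K`-quasi-isometric embedding (additive and multiplicative constants both `K`). -/
def IsQIEmbedding {Y : Type*} [MetricSpace Y] (K : ℝ) (g : Y → X) : Prop :=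
  ∀ y y' : Y, dist y y' / K - K ≤ dist (g y) (g y') ∧ dist (g y) (g y') ≤ K * dist y y' + K

/-! ### The geodesic boundary -/

/-- Geodesic rays `[0, ∞) → X`. -/
def GeodesicRay (X : Type u) [MetricSpace X] : Type u := {α : ℝ≥0 → X // Isometry α}

/-- Two geodesic rays are related if their images are at finite Hausdorff distance. -/
def raySetoid (X : Type u) [MetricSpace X] : Setoid (GeodesicRay X) where
  r α β := Metric.hausdorffEDist (Set.range α.1) (Set.range β.1) ≠ ⊤
  iseqv :=
    { refl := fun α => by simp
      symm := fun {α β} h => by rwa [Metric.hausdorffEDist_comm]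
      trans := fun {α β γ} h h' => ne_top_of_le_ne_top (ENNReal.add_ne_top.2 ⟨h, h'⟩)
        Metric.hausdorffEDist_triangle }

/-- The geodesic boundary `∂X`. -/
def GeodesicBoundary (X : Type u) [MetricSpace X] : Type u := Quotient (raySetoid X)

/-- The point `α(∞)` of `∂X`. -/
def GeodesicRay.endpoint (α : GeodesicRay X) : GeodesicBoundary X := Quotient.mk (raySetoid X) α

/-- `γ(∞) = ξ` for a (possibly discontinuous) path `γ : [0, ∞) → X`, in practice a
quasigeodesic ray: `γ` is at finite Hausdorff distance from a geodesic ray representing `ξ`. -/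
def EndsAt (γ : ℝ≥0 → X) (ξ : GeodesicBoundary X) : Prop :=
  ∃ α : GeodesicRay X, α.endpoint = ξ ∧
    Metric.hausdorffEDist (Set.range γ) (Set.range α.1) ≠ ⊤

/-- The sequence `a` in `X` converges to `ξ ∈ ∂X`: for every base point `p` there are geodesic
segments `c n` from `p` to `a n` such that every subsequence of `c` has a further subsequence
converging, uniformly on compact sets, to a geodesic ray from `p` representing `ξ`. -/
def ConvergesToBoundary (a : ℕ → X) (ξ : GeodesicBoundary X) : Prop :=
  ∀ p : X, ∃ c : ℕ → ℝ≥0 → X, (∀ n, IsGeodesicSegment (c n) p (a n)) ∧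
    ∀ m : ℕ → ℕ, StrictMono m → ∃ l : ℕ → ℕ, StrictMono l ∧
      ∃ α : GeodesicRay X, α.1 0 = p ∧ α.endpoint = ξ ∧
        ∀ T : ℝ≥0, TendstoUniformlyOn (fun k => c (m (l k))) α.1 Filter.atTop (Set.Icc 0 T)

/-- The limit set `Λ_X(A) ⊆ ∂X` of a subset `A` of `X`. -/
def limitSet (A : Set X) : Set (GeodesicBoundary X) :=
  {ξ | ∃ a : ℕ → X, (∀ n, a n ∈ A) ∧ ConvergesToBoundary a ξ}

/-- `∂φ(ξ) = η`, where `∂φ` sends `α(∞)` to `(φ ∘ α)(∞)`. -/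
def BoundaryMapsTo {Y : Type*} [MetricSpace Y] (φ : Y → X) (ξ : GeodesicBoundary Y)
    (η : GeodesicBoundary X) : Prop :=
  ∃ α : GeodesicRay Y, α.endpoint = ξ ∧ EndsAt (φ ∘ α.1) η

/-! ### Barycenters of ideal triangles -/

/-- `β` is a geodesic line with `β(-∞) = ξ` and `β(∞) = η`. -/
structure IsGeodesicLine (β : ℝ → X) (ξ η : GeodesicBoundary X) : Prop where
  isometry : Isometry β
  neg_end : EndsAt (fun t : ℝ≥0 => β (-(t : ℝ))) ξ
  pos_end : EndsAt (fun t : ℝ≥0 => β t) η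

/-- `∂³X`: ordered triples of pairwise distinct boundary points. -/
def BoundaryTriple (X : Type u) [MetricSpace X] : Type u :=
  {ξ : Fin 3 → GeodesicBoundary X // Function.Injective ξ}

/-- `z` is a `D`-barycenter of the ideal triangle with vertices `ξ`: it is `D`-close to every
geodesic line joining two distinct vertices. -/
def IsBarycenter (D : ℝ) (z : X) (ξ : BoundaryTriple X) : Prop :=
  ∀ a b : Fin 3, a ≠ b → ∀ β : ℝ → X, IsGeodesicLine β (ξ.1 a) (ξ.1 b) → ∃ t : ℝ, dist z (β t) ≤ D

end MetricNotions

/-! ### Metric graphs -/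

/-- The structure of a graph without loops on the points of `X`. Multiple edges are allowed. -/
structure GraphStructure (X : Type u) where
  /-- the vertices -/
  vert : Set X
  /-- the index type of the edges -/
  Edge : Type v
  /-- the parametrisation of an edge; only its values on `[0, 1]` matter -/
  param : Edge → ℝ → X
  param_zero_mem : ∀ e, param e 0 ∈ vert
  param_one_mem : ∀ e, param e 1 ∈ vert
  no_loop : ∀ e, param e 0 ≠ param e 1
  interior_notMem : ∀ e, ∀ t ∈ Set.Ioo (0 : ℝ) 1, param e t ∉ vert
  interior_inj : ∀ e e', ∀ t ∈ Set.Ioo (0 : ℝ) 1, ∀ t' ∈ Set.Ioo (0 : ℝ) 1,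
    param e t = param e' t' → e = e' ∧ t = t'
  cover : ∀ x, x ∈ vert ∨ ∃ e, ∃ t ∈ Set.Ioo (0 : ℝ) 1, param e t = x

namespace GraphStructure

variable {X : Type u}

/-- `G.PLPath S x y ℓ`: there is a piecewise linear path in `S ⊆ X` from `x` to `y` of length `ℓ`,
where every edge of the graph has length one. -/
inductive PLPath (G : GraphStructure.{u, v} X) (S : Set X) : X → X → ℝ → Prop
  | nil (x : X) (hx : x ∈ S) : PLPath G S x x 0
  | cons (e : G.Edge) (s t : ℝ) (hs : s ∈ Set.Icc (0 : ℝ) 1) (ht : t ∈ Set.Icc (0 : ℝ) 1)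
      (hS : ∀ r ∈ Set.uIcc s t, G.param e r ∈ S) (y : X) (ℓ : ℝ)
      (h : PLPath G S (G.param e t) y ℓ) : PLPath G S (G.param e s) y (|s - t| + ℓ)

/-- The induced path metric on `S ⊆ X` (meaningful if `S` is path connected). -/
noncomputable def pathDist (G : GraphStructure.{u, v} X) (S : Set X) (x y : X) : ℝ :=
  sInf {ℓ | G.PLPath S x y ℓ}

/-- `x` and `y` are joined by an edge. -/
def Adj (G : GraphStructure.{u, v} X) (x y : X) : Prop :=
  ∃ e, (G.param e 0 = x ∧ G.param e 1 = y) ∨ (G.param e 0 = y ∧ G.param e 1 = x)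

/-- `X` is a connected metric graph with edges of length one: its distance is the infimum of the
lengths of piecewise linear paths. (An infimum of the empty set does not exist in `ℝ`, so this
includes connectedness.) -/
def IsMetricGraph [MetricSpace X] (G : GraphStructure.{u, v} X) : Prop :=
  ∀ x y : X, IsGLB {ℓ | G.PLPath Set.univ x y ℓ} (dist x y)

section Lemmas

variable {G : GraphStructure.{u, v} X} {S : Set X} {x y z : X} {ℓ ℓ' : ℝ}

theorem PLPath.nonneg (h : G.PLPath S x y ℓ) : 0 ≤ ℓ := by
  induction h with
  | nil => exact le_rfl
  | cons e s t _ _ _ _ _ _ ih => exact add_nonneg (abs_nonneg _) ih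

theorem PLPath.mono {S' : Set X} (hS : S ⊆ S') (h : G.PLPath S x y ℓ) : G.PLPath S' x y ℓ := by
  induction h with
  | nil x hx => exact .nil x (hS hx)
  | cons e s t hs ht h' y ℓ _ ih => exact .cons e s t hs ht (fun r hr => hS (h' r hr)) y ℓ ih

theorem PLPath.append (h : G.PLPath S x y ℓ) (h' : G.PLPath S y z ℓ') :
    G.PLPath S x z (ℓ + ℓ') := by
  induction h with
  | nil => simpa using h'
  | cons e s t hs ht hS y ℓ _ ih =>
    rw [add_assoc]
    exact .cons e s t hs ht hS _ _ (ih h')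

theorem PLPath.symm (h : G.PLPath S x y ℓ) : G.PLPath S y x ℓ := by
  induction h with
  | nil x hx => exact .nil x hx
  | cons e s t hs ht hS y ℓ _ ih =>
    have h1 : G.PLPath S (G.param e t) (G.param e s) (|t - s| + 0) :=
      .cons e t s ht hs (fun r hr => hS r (by rwa [Set.uIcc_comm])) _ _
        (.nil _ (hS s Set.left_mem_uIcc))
    have h2 := ih.append h1
    rwa [add_zero, abs_sub_comm, add_comm] at h2

theorem pathDist_le (h : G.PLPath S x y ℓ) : G.pathDist S x y ≤ ℓ :=
  csInf_le ⟨0, fun _ h => h.nonneg⟩ h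

theorem pathDist_comm : G.pathDist S x y = G.pathDist S y x := by
  unfold pathDist
  congr 1
  ext ℓ
  exact ⟨PLPath.symm, PLPath.symm⟩

theorem pathDist_triangle (hxy : ∃ ℓ, G.PLPath S x y ℓ) (hyz : ∃ ℓ, G.PLPath S y z ℓ) :
    G.pathDist S x z ≤ G.pathDist S x y + G.pathDist S y z := by
  refine le_of_forall_pos_le_add fun ε hε => ?_
  obtain ⟨a, ha, ha'⟩ := exists_lt_of_csInf_lt (s := {ℓ | G.PLPath S x y ℓ}) hxy
    (lt_add_of_pos_right (G.pathDist S x y) (half_pos hε))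
  obtain ⟨b, hb, hb'⟩ := exists_lt_of_csInf_lt (s := {ℓ | G.PLPath S y z ℓ}) hyz
    (lt_add_of_pos_right (G.pathDist S y z) (half_pos hε))
  have := pathDist_le (PLPath.append ha hb)
  linarith

theorem IsMetricGraph.dist_le_pathDist [MetricSpace X] (hG : G.IsMetricGraph)
    (hxy : ∃ ℓ, G.PLPath S x y ℓ) : dist x y ≤ G.pathDist S x y :=
  le_csInf hxy fun _ h => (hG x y).1 (h.mono (Set.subset_univ S))

end Lemmas

end GraphStructure

/-! ### Metric graph bundles over `[0, ∞)` -/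

/-- `π : X → [0, ∞)` is an `f`-metric graph bundle, where `[0, ∞)` is the metric graph with vertex
set `ℕ` and edges `[i, i + 1]`. -/
structure IsMetricGraphBundle {X : Type u} [MetricSpace X] (G : GraphStructure.{u, v} X)
    (f : ℕ → ℕ) (π : X → ℝ≥0) : Prop where
  isMetricGraph : G.IsMetricGraph
  tendsto : Filter.Tendsto f Filter.atTop Filter.atTop
  /-- `π` is simplicial: it maps vertices to vertices, and maps every edge affinely onto an edge
  or onto a vertex -/
  map_vert : ∀ x ∈ G.vert, ∃ i : ℕ, π x = i
  map_edge : ∀ e, |(π (G.param e 0) : ℝ) - π (G.param e 1)| ≤ 1 ∧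
    ∀ t ∈ Set.Icc (0 : ℝ) 1,
      (π (G.param e t) : ℝ) = (1 - t) * π (G.param e 0) + t * π (G.param e 1)
  surjective : Function.Surjective π
  lipschitz : LipschitzWith 1 π
  /-- the fiber over a vertex is connected -/
  fiber_connected : ∀ i : ℕ, ∀ x ∈ π ⁻¹' {(i : ℝ≥0)}, ∀ y ∈ π ⁻¹' {(i : ℝ≥0)},
    ∃ ℓ, G.PLPath (π ⁻¹' {(i : ℝ≥0)}) x y ℓ
  /-- the inclusion of the fiber, with its path metric, into `X` is an `f`-proper embedding -/
  fiber_proper : ∀ i : ℕ, ∀ x ∈ π ⁻¹' {(i : ℝ≥0)}, ∀ y ∈ π ⁻¹' {(i : ℝ≥0)},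
    ∀ r : ℕ, dist x y ≤ r → G.pathDist (π ⁻¹' {(i : ℝ≥0)}) x y ≤ f r
  /-- every vertex over `i` is joined by an edge to some vertex over each neighbour of `i` -/
  exists_adj : ∀ i j : ℕ, (j = i + 1 ∨ i = j + 1) → ∀ x ∈ G.vert, π x = i →
    ∃ y ∈ G.vert, π y = j ∧ G.Adj x y

namespace IsMetricGraphBundle

variable {X : Type u} [MetricSpace X] {G : GraphStructure.{u, v} X} {f : ℕ → ℕ} {π : X → ℝ≥0}

/-- The fiber `F_i = π⁻¹(i)` over the vertex `i`; it carries the induced path metric `d_i`. -/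
structure Fiber (h : IsMetricGraphBundle G f π) (i : ℕ) : Type u where
  val : X
  mem : π val = i

noncomputable instance (h : IsMetricGraphBundle G f π) (i : ℕ) : MetricSpace (h.Fiber i) where
  dist x y := G.pathDist (π ⁻¹' {(i : ℝ≥0)}) x.1 y.1
  dist_self x := le_antisymm (GraphStructure.pathDist_le (.nil x.1 x.2))
    (Real.sInf_nonneg fun _ hℓ => hℓ.nonneg)
  dist_comm x y := GraphStructure.pathDist_comm
  dist_triangle x y z := GraphStructure.pathDist_triangle
    (h.fiber_connected i x.1 x.2 y.1 y.2) (h.fiber_connected i y.1 y.2 z.1 z.2)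
  eq_of_dist_eq_zero {x y} hxy := by
    have hle := (h.isMetricGraph.dist_le_pathDist
      (h.fiber_connected i x.1 x.2 y.1 y.2)).trans hxy.le
    cases x
    cases y
    congr
    exact dist_le_zero.1 hle

/-- Controlled hyperbolic fibers with parameters `δ` and `L`: all fibers are `δ`-hyperbolic, and
the barycenter maps of the fibers (which send a boundary triple to a `D`-barycenter of it, `D`
being the same for all fibers) are `L`-coarsely surjective. -/
def HasControlledHyperbolicFibers (h : IsMetricGraphBundle G f π) (δ L : ℝ) : Prop :=
  (∀ i, IsHyperbolic δ (h.Fiber i)) ∧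
    ∃ D : ℝ, ∀ i, ∃ bary : BoundaryTriple (h.Fiber i) → h.Fiber i,
      (∀ ξ, IsBarycenter D (bary ξ) ξ) ∧ ∀ x, ∃ ξ, dist x (bary ξ) ≤ L

/-- A natural quasi-isometry `F_i → F_{i+1}`: a vertex `v` is sent to a vertex joined to `v` by an
edge of `X`, and any other point has the same image as an end vertex of an edge of `F_i`
containing it. -/
structure IsNaturalMap (h : IsMetricGraphBundle G f π) (i : ℕ)
    (φ : h.Fiber i → h.Fiber (i + 1)) : Prop where
  map_vert : ∀ x, x.1 ∈ G.vert → (φ x).1 ∈ G.vert ∧ G.Adj x.1 (φ x).1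
  map_interior : ∀ x, x.1 ∉ G.vert → ∃ v, v.1 ∈ G.vert ∧ dist x v < 1 ∧ φ x = φ v

/-- A `K`-qi section of `π` over `[0, ∞)`. -/
structure IsQISection (π : X → ℝ≥0) (K : ℝ) (σ : ℝ≥0 → X) : Prop where
  qi : IsQIEmbedding K σ
  map_nat : ∀ i : ℕ, π (σ i) = i

/-- A good `K`-qi section: there are ideal triangles in the fibers, each sent to the next one by
the boundary maps of the natural quasi-isometries `φ i`, of which the points `σ i` are
`K`-barycenters. -/
def IsGoodQISection (h : IsMetricGraphBundle G f π) (φ : ∀ i, h.Fiber i → h.Fiber (i + 1))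
    (K : ℝ) (σ : ℝ≥0 → X) : Prop :=
  ∃ hσ : IsQISection π K σ, ∃ ξ : ∀ i, BoundaryTriple (h.Fiber i),
    (∀ i, IsBarycenter K (⟨σ i, hσ.map_nat i⟩ : h.Fiber i) (ξ i)) ∧
      ∀ i j, BoundaryMapsTo (φ i) ((ξ i).1 j) ((ξ (i + 1)).1 j)

/-- `∂_good X`, the set of endpoints of good `K`-qi sections over `[0, ∞)`. -/
def goodBoundary (h : IsMetricGraphBundle G f π) (φ : ∀ i, h.Fiber i → h.Fiber (i + 1))
    (K : ℝ) : Set (GeodesicBoundary X) :=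
  {ξ | ∃ σ : ℝ≥0 → X, h.IsGoodQISection φ K σ ∧ EndsAt σ ξ}

end IsMetricGraphBundle

/-! Let `α` be a geodesic ray of `X`. Each `α n` is near a vertex of some fiber, hence, by coarse
surjectivity, at bounded distance from a barycenter of an ideal triangle in that fiber. Neighbouring
fibers are uniformly quasi-isometric, so this triangle can be transported to every fiber, upwards
and, by coarse inverses, downwards. Its centers form a qi section passing near `α n`. The constants
of the section depend on `δ` and `f` only, because the given barycenters are replaced by centers
with a universal constant (`exists_isCenter`); `L` and the barycenter constant affect only the
distance from `α n` to the section.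

Consider where these sections start in the fiber over `0`. If infinitely many starting points lie in
a bounded set, properness of the fibers gives a limit section, and the Morse lemma shows that it
stays near `α`; it is good and ends at `α.endpoint` (`exists_tripodFlow_endsAt`). Otherwise the
starting points leave every bounded set. A section meeting a fixed ball does so after boundedly many
steps, since `π` is `1`-Lipschitz, so it starts near that ball; hence late sections avoid the ball.
By the Morse lemma the Gromov products of the starting points with `α n` tend to infinity, and
`α.endpoint` is a limit point of the fiber over `0` (`endpoint_mem_limitSet`).

Two devices make the limits work. Ideal triangles are recorded as tripods of geodesic rays
(`TripodFlow`): the conditions on these are closed and pass to pointwise limits (`exists_limit`), so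
no topology on the boundaries of the fibers is needed. And `X` need not be proper, as infinitely
many edges may join the same two vertices; folding parallel edges (`exists_retraction`) still gives
geodesics to vertices with limits (`HasCompactGeodesics`). Hyperbolicity is used throughout as the
four point inequality for Gromov products. -/

/-! ### Gromov products -/

section GromovProduct

variable {X : Type u} [MetricSpace X]

/-- The Gromov product of `x` and `y` based at `w`. -/
noncomputable def gromovProd (w x y : X) : ℝ := (dist w x + dist w y - dist x y) / 2

theorem gromovProd_comm (w x y : X) : gromovProd w x y = gromovProd w y x := by
  unfold gromovProd
  rw [dist_comm x y]
  ring

theorem gromovProd_nonneg (w x y : X) : 0 ≤ gromovProd w x y := by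
  unfold gromovProd
  have := dist_triangle x w y
  rw [dist_comm x w] at this
  linarith

theorem gromovProd_le_dist (w x y : X) : gromovProd w x y ≤ dist w x := by
  unfold gromovProd
  have := dist_triangle w x y
  linarith

theorem gromovProd_le_dist_right (w x y : X) : gromovProd w x y ≤ dist w y := by
  rw [gromovProd_comm]
  exact gromovProd_le_dist w y x

theorem gromovProd_le_base (w w' x y : X) :
    gromovProd w x y ≤ gromovProd w' x y + dist w w' := by
  unfold gromovProd
  have := dist_triangle w w' x
  have := dist_triangle w w' y
  linarith

theorem gromovProd_le_left (w x x' y : X) :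
    gromovProd w x y ≤ gromovProd w x' y + dist x x' := by
  unfold gromovProd
  have := dist_triangle_right w x x'
  have := dist_triangle w x' x
  have := dist_triangle x' x y
  rw [dist_comm x' x] at *
  linarith

theorem gromovProd_le_right (w x y y' : X) :
    gromovProd w x y ≤ gromovProd w x y' + dist y y' := by
  rw [gromovProd_comm w x y, gromovProd_comm w x y']
  exact gromovProd_le_left w y y' x

theorem dist_sub_dist_le_gromovProd (w x y : X) : dist w x - dist x y ≤ gromovProd w x y := by
  unfold gromovProd
  have := dist_triangle w y x
  rw [dist_comm y x] at this
  linarith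

/-- The Gromov product decreases when a point is moved towards the base point. -/
theorem gromovProd_le_of_between {w x x' : X} (y : X) (h : dist w x' + dist x' x = dist w x) :
    gromovProd w x' y ≤ gromovProd w x y := by
  unfold gromovProd
  have := dist_triangle_left x y x'
  linarith

theorem gromovProd_le_dist_of_between {w x y z : X} (h : dist x z + dist z y = dist x y) :
    gromovProd w x y ≤ dist w z := by
  unfold gromovProd
  have := dist_triangle w z x
  have := dist_triangle w z y
  rw [dist_comm z x] at *
  linarith

theorem gromovProd_eq_zero_of_between {x y z : X} (h : dist x z + dist z y = dist x y) :
    gromovProd z x y = 0 := by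
  unfold gromovProd
  rw [dist_comm z x]
  linarith

end GromovProduct

/-! ### Geodesic segments -/

namespace IsGeodesicSegment

variable {X : Type u} [MetricSpace X] {c : ℝ≥0 → X} {x y : X}

theorem apply_min (h : IsGeodesicSegment c x y) (t : ℝ≥0) : c (min t (nndist x y)) = c t := by
  rcases le_total t (nndist x y) with ht | ht
  · rw [min_eq_left ht]
  · rw [min_eq_right ht, h.target t ht, h.target _ le_rfl]

theorem dist_eq (h : IsGeodesicSegment c x y) (s t : ℝ≥0) :
    dist (c s) (c t) = dist (min s (nndist x y)) (min t (nndist x y)) := by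
  rw [← h.apply_min s, ← h.apply_min t]
  exact h.isometric _ _ (min_le_right _ _) (min_le_right _ _)

theorem dist_le (h : IsGeodesicSegment c x y) (s t : ℝ≥0) : dist (c s) (c t) ≤ dist s t := by
  rw [h.dist_eq, NNReal.dist_eq, NNReal.dist_eq, NNReal.coe_min, NNReal.coe_min]
  exact (abs_min_sub_min_le_max _ _ _ _).trans (by simp)

theorem lipschitzWith (h : IsGeodesicSegment c x y) : LipschitzWith 1 c :=
  LipschitzWith.of_dist_le_mul fun s t => by simpa using h.dist_le s t

theorem dist_source (h : IsGeodesicSegment c x y) (t : ℝ≥0) :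
    dist x (c t) = min (t : ℝ) (dist x y) := by
  conv_lhs => rw [← h.source]
  rw [h.dist_eq, NNReal.dist_eq]
  simp only [zero_le, inf_of_le_left, NNReal.coe_zero, NNReal.coe_min, coe_nndist, zero_sub,
    abs_neg]
  exact abs_of_nonneg (le_min t.2 dist_nonneg)

theorem between (h : IsGeodesicSegment c x y) (t : ℝ≥0) :
    dist x (c t) + dist (c t) y = dist x y := by
  have hy : dist (c t) y = dist (c t) (c (nndist x y)) := by rw [h.target _ le_rfl]
  rw [h.dist_source, hy, h.dist_eq, NNReal.dist_eq, min_self, NNReal.coe_min, coe_nndist, abs_sub_comm,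
    abs_of_nonneg (sub_nonneg.2 (min_le_right _ _))]
  ring

/-- If some piece of the segment were shortened, the endpoints would come closer too. This is
applied to the folding of parallel edges. -/
theorem map_of_lipschitz (h : IsGeodesicSegment c x y) {Z : Type*} [MetricSpace Z] {ρ : X → Z}
    (hρ : LipschitzWith 1 ρ) (hxy : dist (ρ x) (ρ y) = dist x y) :
    IsGeodesicSegment (ρ ∘ c) (ρ x) (ρ y) := by
  have hd : nndist (ρ x) (ρ y) = nndist x y := NNReal.eq hxy
  have hL : ∀ a b, dist (ρ a) (ρ b) ≤ dist a b := fun a b => by simpa using hρ.dist_le_mul a b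
  have key : ∀ s t : ℝ≥0, s ≤ t → t ≤ nndist x y → dist (ρ (c s)) (ρ (c t)) = dist s t := by
    intro s t hst ht
    refine le_antisymm ((hL _ _).trans (h.dist_le s t)) ?_
    have h1 := dist_triangle4 (ρ x) (ρ (c s)) (ρ (c t)) (ρ y)
    have h2 := hL x (c s)
    have h3 := hL (c t) y
    have h4 := h.dist_source s
    have h5 := h.dist_source t
    have h6 := h.between t
    have ht' : (t : ℝ) ≤ dist x y := ht
    have hst' : (s : ℝ) ≤ t := hst
    rw [min_eq_left (hst'.trans ht')] at h4
    rw [min_eq_left ht'] at h5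
    rw [NNReal.dist_eq, abs_sub_comm, abs_of_nonneg (sub_nonneg.2 hst')]
    linarith
  refine ⟨by simp [h.source], fun s t hs ht => ?_, fun t ht => ?_⟩
  · rw [hd] at hs ht
    rcases le_total s t with hst | hst
    · exact key s t hst ht
    · rw [dist_comm, dist_comm s]
      exact key t s hst hs
  · rw [hd] at ht
    simp [h.target t ht]

end IsGeodesicSegment

/-! ### Gromov hyperbolic spaces -/

/-- A geodesic metric space satisfying Gromov's four point condition. -/
structure GromovHyperbolic (δ : ℝ) (X : Type u) [MetricSpace X] : Prop where
  nonneg : 0 ≤ δ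
  geodesic : ∀ x y : X, ∃ c : ℝ≥0 → X, IsGeodesicSegment c x y
  four_point : ∀ w x y z : X, min (gromovProd w x y) (gromovProd w y z) ≤ gromovProd w x z + δ

section Hyperbolic

variable {X : Type u} [MetricSpace X] {δ : ℝ}

/-- By the intermediate value theorem some point of the side `c` is equally far from the other two
sides. Slimness puts it within `δ` of one of them, hence of both; adding triangle inequalities gives
the bound, with `1` lost per side because the infima need not be attained. -/
theorem IsHyperbolic.exists_dist_le_gromovProd (hX : IsHyperbolic δ X) {x y : X} (w : X)
    {c : ℝ≥0 → X} (hc : IsGeodesicSegment c x y) :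
    ∃ t, dist w (c t) ≤ gromovProd w x y + 2 * δ + 2 := by
  obtain ⟨c₂, h₂⟩ := hX.geodesic y w
  obtain ⟨c₃, h₃⟩ := hX.geodesic x w
  let F : ℝ≥0 → ℝ := fun s => Metric.infDist (c s) (Set.range c₃) - Metric.infDist (c s)
    (Set.range c₂)
  have hF : Continuous F :=
    ((Metric.continuous_infDist_pt _).comp hc.lipschitzWith.continuous).sub
      ((Metric.continuous_infDist_pt _).comp hc.lipschitzWith.continuous)
  have h0 : F 0 ≤ 0 := by
    have : Metric.infDist (c 0) (Set.range c₃) = 0 :=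
      Metric.infDist_zero_of_mem ⟨0, by rw [h₃.source, hc.source]⟩
    simp only [F, this, zero_sub, Left.neg_nonpos_iff]
    exact Metric.infDist_nonneg
  have h1 : 0 ≤ F (nndist x y) := by
    have : Metric.infDist (c (nndist x y)) (Set.range c₂) = 0 :=
      Metric.infDist_zero_of_mem ⟨0, by rw [h₂.source, hc.target _ le_rfl]⟩
    simp only [F, this, sub_zero]
    exact Metric.infDist_nonneg
  obtain ⟨t, -, ht⟩ := intermediate_value_Icc (zero_le : 0 ≤ nndist x y) hF.continuousOn ⟨h0, h1⟩
  have heq : Metric.infDist (c t) (Set.range c₃) = Metric.infDist (c t) (Set.range c₂) :=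
    sub_eq_zero.1 ht
  have hle : Metric.infDist (c t) (Set.range c₂) ≤ δ := by
    obtain ⟨q, hq, hd⟩ := hX.slim x y w c c₂ c₃ hc h₂ h₃ (c t) ⟨t, rfl⟩
    rcases hq with hq | hq
    · exact (Metric.infDist_le_dist_of_mem hq).trans hd
    · exact heq ▸ (Metric.infDist_le_dist_of_mem hq).trans hd
  obtain ⟨_, ⟨a, rfl⟩, ha⟩ := (Metric.infDist_lt_iff (Set.range_nonempty c₂)).1
    (lt_of_le_of_lt hle (lt_add_one δ))
  obtain ⟨_, ⟨b, rfl⟩, hb⟩ := (Metric.infDist_lt_iff (Set.range_nonempty c₃)).1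
    (lt_of_le_of_lt (heq.trans_le hle) (lt_add_one δ))
  refine ⟨t, ?_⟩
  have e1 := hc.between t
  have e2 := h₂.between a
  have e3 := h₃.between b
  have i1 := dist_triangle_right x (c t) (c₃ b)
  have i2 := dist_triangle_right y (c t) (c₂ a)
  have i3 := dist_triangle_right w (c t) (c₃ b)
  have i4 := dist_triangle_right w (c t) (c₂ a)
  unfold gromovProd
  rw [dist_comm w x, dist_comm w y]
  rw [dist_comm (c₃ b) w] at e3
  rw [dist_comm (c₂ a) w] at e2
  rw [dist_comm (c t) y] at e1
  linarith

/-- The product of `x` and `z` at `w` is almost the distance from `w` to a point of a geodesic `xz`.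
That point is `δ`-close to a side through `y`, and the product of the ends of that side is at most
the distance from `w` to any of its points. -/
theorem IsHyperbolic.gromovHyperbolic (hX : IsHyperbolic δ X) (hδ : 0 ≤ δ) :
    GromovHyperbolic (3 * δ + 2) X := by
  refine ⟨by linarith, hX.geodesic, fun w x y z => ?_⟩
  obtain ⟨c₁, h₁⟩ := hX.geodesic x z
  obtain ⟨c₂, h₂⟩ := hX.geodesic z y
  obtain ⟨c₃, h₃⟩ := hX.geodesic x y
  obtain ⟨t, ht⟩ := hX.exists_dist_le_gromovProd w h₁
  obtain ⟨_, ⟨a, rfl⟩ | ⟨a, rfl⟩, hd⟩ := hX.slim x z y c₁ c₂ c₃ h₁ h₂ h₃ (c₁ t) ⟨t, rfl⟩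
  · refine (min_le_right _ _).trans ?_
    have := gromovProd_le_dist_of_between (w := w) (h₂.between a)
    rw [gromovProd_comm w y z]
    linarith [dist_triangle w (c₁ t) (c₂ a)]
  · refine (min_le_left _ _).trans ?_
    have := gromovProd_le_dist_of_between (w := w) (h₃.between a)
    linarith [dist_triangle w (c₁ t) (c₃ a)]

namespace GromovHyperbolic

variable (hX : GromovHyperbolic δ X)
include hX

/-- The form in which the four point condition is mostly used: if `y` and `z` lie in the same
direction from `w`, a bound on the product with one is a bound on the product with the other. -/
theorem gromovProd_le_of_lt {w x y z : X} {M : ℝ} (h : gromovProd w x z ≤ M)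
    (h' : M + δ < gromovProd w y z) : gromovProd w x y ≤ M + δ := by
  have := hX.four_point w x y z
  rcases min_le_iff.1 this with h1 | h1 <;> linarith

/-- A point `z` between `x` and `y` at the distance from `x` of the internal point of the
triangle `x, y, w`. -/
theorem dist_le_of_between {x y z : X} (w : X) (h : dist x z + dist z y = dist x y)
    (hz : dist x z = gromovProd x w y) : dist w z ≤ gromovProd w x y + 2 * δ := by
  have h4 := hX.four_point z x w y
  rw [gromovProd_eq_zero_of_between h] at h4
  unfold gromovProd at *
  rw [dist_comm z x, dist_comm z w] at h4
  rw [dist_comm x w] at *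
  rw [dist_comm w y] at *
  rw [dist_comm y w] at *
  rcases min_le_iff.1 h4 with h1 | h1 <;> linarith

theorem exists_dist_le {x y : X} (w : X) {c : ℝ≥0 → X} (hc : IsGeodesicSegment c x y) :
    ∃ t : ℝ≥0, (t : ℝ) ≤ dist x w ∧ t ≤ nndist x y ∧ dist w (c t) ≤ gromovProd w x y + 2 * δ := by
  have h1 := gromovProd_le_dist_right x w y
  let t : ℝ≥0 := ⟨gromovProd x w y, gromovProd_nonneg _ _ _⟩
  exact ⟨t, gromovProd_le_dist _ _ _, h1,
    hX.dist_le_of_between w (hc.between t) ((hc.dist_source t).trans (min_eq_left h1))⟩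

/-- Every triangle has a center. -/
theorem exists_center (x : Fin 3 → X) : ∃ z, ∀ a b, a ≠ b → gromovProd z (x a) (x b) ≤ δ := by
  obtain ⟨c, hc⟩ := hX.geodesic (x 0) (x 1)
  let t : ℝ≥0 := ⟨gromovProd (x 0) (x 2) (x 1), gromovProd_nonneg _ _ _⟩
  have ht : dist (x 0) (c t) = gromovProd (x 0) (x 2) (x 1) := by
    rw [hc.dist_source]
    exact min_eq_left (gromovProd_le_dist_right _ _ _)
  have hb := hc.between t
  have h2 := hX.dist_le_of_between (x 2) hb ht
  have h01 := gromovProd_eq_zero_of_between hb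
  have hδ := hX.nonneg
  refine ⟨c t, ?_⟩
  have h01' : gromovProd (c t) (x 0) (x 1) ≤ δ := h01.trans_le hδ
  have h02 : gromovProd (c t) (x 0) (x 2) ≤ δ := by
    unfold gromovProd at *
    linarith [dist_comm (c t) (x 0), dist_comm (c t) (x 1), dist_comm (c t) (x 2),
      dist_comm (x 0) (x 1), dist_comm (x 0) (x 2), dist_comm (x 1) (x 2)]
  have h12 : gromovProd (c t) (x 1) (x 2) ≤ δ := by
    unfold gromovProd at *
    linarith [dist_comm (c t) (x 0), dist_comm (c t) (x 1), dist_comm (c t) (x 2),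
      dist_comm (x 0) (x 1), dist_comm (x 0) (x 2), dist_comm (x 1) (x 2)]
  intro a b hab
  fin_cases a <;> fin_cases b
  · exact absurd rfl hab
  · exact h01'
  · exact h02
  · rw [gromovProd_comm]; exact h01'
  · exact absurd rfl hab
  · exact h12
  · rw [gromovProd_comm]; exact h02
  · rw [gromovProd_comm]; exact h12
  · exact absurd rfl hab

/-- Centers of the same triangle are close to each other. -/
theorem dist_centers_le {x : Fin 3 → X} {z z' : X} {D D' : ℝ}
    (h : ∀ a b, a ≠ b → gromovProd z (x a) (x b) ≤ D)
    (h' : ∀ a b, a ≠ b → gromovProd z' (x a) (x b) ≤ D') : dist z z' ≤ D' + 2 * D + 2 * δ := by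
  have key : ∀ a b, a ≠ b → gromovProd z (x a) z' ≤ D + δ → gromovProd z (x b) z' ≤ D + δ →
      dist z z' ≤ D' + 2 * D + 2 * δ := by
    intro a b hab ha hb
    have h2 := h' a b hab
    have h3 := gromovProd_nonneg z (x a) (x b)
    unfold gromovProd at *
    rw [dist_comm (x a) z'] at *
    rw [dist_comm (x b) z'] at *
    linarith
  have alt : ∀ a b, a ≠ b → gromovProd z (x a) z' ≤ D + δ ∨ gromovProd z (x b) z' ≤ D + δ := by
    intro a b hab
    have h4 := hX.four_point z (x a) z' (x b)
    rw [gromovProd_comm z z' (x b)] at h4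
    rcases min_le_iff.1 h4 with h5 | h5
    · exact .inl (by linarith [h a b hab])
    · exact .inr (by linarith [h a b hab])
  have n01 : (0 : Fin 3) ≠ 1 := by decide
  have n02 : (0 : Fin 3) ≠ 2 := by decide
  have n12 : (1 : Fin 3) ≠ 2 := by decide
  rcases alt 0 1 n01 with h0 | h1
  · rcases alt 1 2 n12 with h1 | h2
    · exact key 0 1 n01 h0 h1
    · exact key 0 2 n02 h0 h2
  · rcases alt 0 2 n02 with h0 | h2
    · exact key 0 1 n01 h0 h1
    · exact key 1 2 n12 h1 h2

/-- Halving the chain costs one `δ` per level, so the loss is only logarithmic in its length. This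
is what makes the Morse lemma work. -/
theorem gromovProd_chain_ge (k : ℕ) : ∀ (g : ℕ → X) (n : ℕ) (p : X) (r : ℝ), 0 < n → n ≤ 2 ^ k →
    (∀ i < n, r ≤ gromovProd p (g i) (g (i + 1))) → r - k * δ ≤ gromovProd p (g 0) (g n) := by
  induction k with
  | zero =>
    intro g n p r h0 hn h
    obtain rfl : n = 1 := by simp at hn; omega
    simpa using h 0 one_pos
  | succ k ih =>
    intro g n p r h0 hn h
    have hδ := hX.nonneg
    rcases Nat.lt_or_ge (2 ^ k) n with hk | hk
    · have h1 := ih g (2 ^ k) p r (by positivity) le_rfl fun i hi => h i (hi.trans hk)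
      have h2 := ih (fun i => g (2 ^ k + i)) (n - 2 ^ k) p r (by omega)
        (by rw [pow_succ] at hn; omega) fun i hi => by
          have := h (2 ^ k + i) (by omega)
          rwa [add_assoc] at this
      simp only [add_zero] at h2
      rw [Nat.add_sub_cancel' hk.le] at h2
      have h3 := hX.four_point p (g 0) (g (2 ^ k)) (g n)
      have := le_min h1 h2
      push_cast
      linarith
    · have := ih g n p r h0 hk h
      push_cast
      linarith

end GromovHyperbolic

end Hyperbolic

/-! ### The Morse lemma -/

/-- The hypothesis bounds `D` by a multiple of its own logarithm. For the least admissible `m`,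
either `m` is small or `2 ^ (m - 1)` already exceeds the linear expression, against minimality. -/
theorem exists_forall_le_of_le_mul_log {K δ : ℝ} (hK : 0 ≤ K) (hδ : 0 ≤ δ) :
    ∃ M : ℝ, ∀ D : ℝ, (∀ m : ℕ, K * (6 * D) + K ≤ 2 ^ m → D ≤ K + 2 * δ + m * δ) → D ≤ M := by
  have hlin : ∃ m₁ : ℕ, ∀ m : ℕ, m₁ ≤ m →
      K * (6 * (K + 2 * δ + ((m : ℝ) + 1) * δ)) + K ≤ 2 ^ m := by
    have h1 : Filter.Tendsto (fun m : ℕ => (m : ℝ) ^ 1 / 2 ^ m) Filter.atTop (nhds 0) :=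
      tendsto_pow_const_div_const_pow_of_one_lt 1 one_lt_two
    have h0 : Filter.Tendsto (fun m : ℕ => (m : ℝ) ^ 0 / 2 ^ m) Filter.atTop (nhds 0) :=
      tendsto_pow_const_div_const_pow_of_one_lt 0 one_lt_two
    have h2 := (h1.const_mul (6 * K * δ)).add (h0.const_mul (K * (6 * (K + 3 * δ)) + K))
    simp only [mul_zero, add_zero] at h2
    obtain ⟨m₁, hm₁⟩ := Filter.eventually_atTop.1 (h2.eventually (gt_mem_nhds one_pos))
    refine ⟨m₁, fun m hm => ?_⟩
    have h3 := hm₁ m hm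
    rw [pow_one, pow_zero, ← mul_div_assoc, ← mul_div_assoc, ← add_div,
      div_lt_one (by positivity)] at h3
    linarith
  obtain ⟨m₁, hm₁⟩ := hlin
  refine ⟨K + 2 * δ + m₁ * δ, fun D hD => ?_⟩
  have hex : ∃ m : ℕ, K * (6 * D) + K ≤ 2 ^ m :=
    (pow_unbounded_of_one_lt _ one_lt_two).imp fun _ h => h.le
  classical
  obtain ⟨m, hm, hmin⟩ : ∃ m : ℕ, K * (6 * D) + K ≤ 2 ^ m ∧
      ∀ k < m, ¬ K * (6 * D) + K ≤ 2 ^ k := ⟨Nat.find hex, Nat.find_spec hex,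
    fun k hk => Nat.find_min hex hk⟩
  have hDm := hD m hm
  rcases le_or_gt m m₁ with h | h
  · have : (m : ℝ) ≤ m₁ := by exact_mod_cast h
    nlinarith
  · obtain ⟨k, rfl⟩ : ∃ k, m = k + 1 := ⟨m - 1, by omega⟩
    have h1 := hm₁ k (by omega)
    have h2 := hmin k (by omega)
    push_cast at hDm
    exact absurd ((by gcongr : K * (6 * D) + K ≤ _).trans h1) h2

/-- `g 0, …, g n` is a discrete `K`-quasigeodesic. -/
structure IsQuasiGeodesicSeq {X : Type u} [MetricSpace X] (K : ℝ) (g : ℕ → X) (n : ℕ) : Prop where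
  step : ∀ i < n, dist (g i) (g (i + 1)) ≤ K
  sub_le : ∀ i j, i ≤ j → j ≤ n → (j : ℝ) - i ≤ K * dist (g i) (g j) + K

namespace IsQuasiGeodesicSeq

variable {X : Type u} [MetricSpace X] {K : ℝ} {g : ℕ → X} {n : ℕ}

theorem dist_le (hg : IsQuasiGeodesicSeq K g n) {i j : ℕ} (hij : i ≤ j) (hj : j ≤ n) :
    dist (g i) (g j) ≤ K * ((j : ℝ) - i) := by
  have h := dist_le_Ico_sum_of_dist_le (f := g) hij (d := fun _ => K)
    fun {k} _ hk => hg.step k (hk.trans_le hj)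
  rw [Finset.sum_const, Nat.card_Ico, nsmul_eq_mul, Nat.cast_sub hij] at h
  linarith

end IsQuasiGeodesicSeq

theorem GromovHyperbolic.gromovProd_quasiGeodesicSeq_ge {X : Type u} [MetricSpace X] {δ K D : ℝ}
    (hX : GromovHyperbolic δ X) {g : ℕ → X} {n : ℕ} (hg : IsQuasiGeodesicSeq K g n) {p : X}
    (hD : ∀ i ≤ n, D ≤ dist p (g i)) {m j k : ℕ} (hjk : j < k) (hk : k ≤ n)
    (hm : ((k : ℝ) - j) ≤ 2 ^ m) : D - K - m * δ ≤ gromovProd p (g j) (g k) := by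
  have := hX.gromovProd_chain_ge m (fun i => g (j + i)) (k - j) p (D - K) (by omega)
    (by
      have : ((k - j : ℕ) : ℝ) ≤ ((2 ^ m : ℕ) : ℝ) := by
        rw [Nat.cast_sub hjk.le]; push_cast; exact hm
      exact_mod_cast this)
    fun i hi => by
      have h1 := hg.step (j + i) (by omega)
      have h2 := dist_sub_dist_le_gromovProd p (g (j + i)) (g (j + i + 1))
      have h3 := hD (j + i) (by omega)
      rw [← add_assoc]
      linarith
  simpa [Nat.add_sub_cancel' hjk.le] using this

/-- Geodesics stay close to quasigeodesics with the same end points. -/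
theorem exists_dist_quasiGeodesicSeq_le {δ K : ℝ} (hδ : 0 ≤ δ) (hK : 0 ≤ K) :
    ∃ M : ℝ, ∀ (X : Type u) [MetricSpace X], GromovHyperbolic δ X → ∀ (g : ℕ → X) (n : ℕ),
      IsQuasiGeodesicSeq K g n → ∀ c, IsGeodesicSegment c (g 0) (g n) → ∀ t, ∃ j ≤ n,
        dist (c t) (g j) ≤ M := by
  obtain ⟨M, hM⟩ := exists_forall_le_of_le_mul_log hK hδ
  refine ⟨M, fun X _ hX g n hg c hc t => ?_⟩
  set S : Set X := g '' Set.Iic n with hS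
  have hSc : IsCompact S := ((Set.finite_Iic n).image g).isCompact
  have hSn : S.Nonempty := ⟨g 0, 0, Nat.zero_le n, rfl⟩
  have near : ∀ x, ∃ j ≤ n, Metric.infDist x S = dist x (g j) := fun x => by
    obtain ⟨_, ⟨j, hj, rfl⟩, h⟩ := hSc.exists_infDist_eq_dist hSn x
    exact ⟨j, hj, h⟩
  have hcont : Continuous fun s => Metric.infDist (c s) S :=
    (Metric.continuous_infDist_pt S).comp hc.lipschitzWith.continuous
  -- The point of the geodesic farthest from the quasigeodesic. The aim is that its distance `D`
  -- satisfies the logarithmic bound.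
  obtain ⟨t₀, ht₀, hmax⟩ := (isCompact_Icc (a := (0 : ℝ≥0)) (b := nndist (g 0) (g n))).exists_isMaxOn
    ⟨0, by simp⟩ hcont.continuousOn
  set D := Metric.infDist (c t₀) S with hDdef
  have hD0 : 0 ≤ D := Metric.infDist_nonneg
  have hle : ∀ s, Metric.infDist (c s) S ≤ D := fun s => by
    rw [← hc.apply_min s]
    exact hmax ⟨zero_le, min_le_right _ _⟩
  have hDle : ∀ i ≤ n, D ≤ dist (c t₀) (g i) := fun i hi =>
    Metric.infDist_le_dist_of_mem ⟨i, hi, rfl⟩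
  obtain ⟨j', hj', hjd⟩ := near (c t)
  refine ⟨j', hj', hjd.symm.le.trans ((hle t).trans (hM D fun m hm => ?_))⟩
  have ht₀' : (t₀ : ℝ) ≤ dist (g 0) (g n) := ht₀.2
  let E : ℝ≥0 := ⟨2 * D, by positivity⟩
  have hE : (E : ℝ) = 2 * D := rfl
  -- Going `2 * D` away from `c t₀`, or stopping at an end, leads to a point `c s` within `D` of
  -- some `g j` whose product with it at `c t₀` is at least `(2D + D - D) / 2 = D`.
  have side : ∀ s : ℝ≥0, (dist t₀ s ≤ 2 * D) → (s = 0 ∨ nndist (g 0) (g n) ≤ s ∨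
      dist (c t₀) (c s) = 2 * D) → ∃ j ≤ n, D ≤ gromovProd (c t₀) (c s) (g j) ∧
        dist (c s) (g j) ≤ D := by
    intro s _ hs
    rcases hs with rfl | hs | hs
    · refine ⟨0, Nat.zero_le n, ?_, by rw [hc.source, dist_self]; exact hD0⟩
      have := hDle 0 (Nat.zero_le n)
      simp only [hc.source, gromovProd, dist_self]
      linarith
    · refine ⟨n, le_rfl, ?_, by rw [hc.target s hs, dist_self]; exact hD0⟩
      have := hDle n le_rfl
      simp only [hc.target s hs, gromovProd, dist_self]
      linarith
    · obtain ⟨j, hj, h⟩ := near (c s)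
      have h1 := hle s
      have h2 := hDle j hj
      refine ⟨j, hj, ?_, by linarith⟩
      unfold gromovProd
      linarith
  have hL : ∃ s, s ≤ t₀ ∧ dist t₀ s ≤ 2 * D ∧ (s = 0 ∨ dist (c t₀) (c s) = 2 * D) := by
    -- Truncated subtraction stops at the initial point when `t₀ ≤ 2 * D`.
    refine ⟨t₀ - E, tsub_le_self, ?_, ?_⟩
    · rcases le_total t₀ E with h | h
      · rw [tsub_eq_zero_of_le h, NNReal.dist_eq, NNReal.coe_zero, sub_zero, abs_of_nonneg t₀.coe_nonneg]
        exact h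
      · rw [NNReal.dist_eq, NNReal.coe_sub h, sub_sub_cancel, hE, abs_of_nonneg (by positivity)]
    · rcases le_total t₀ E with h | h
      · exact .inl (tsub_eq_zero_of_le h)
      · right
        rw [hc.isometric _ _ ht₀.2 (tsub_le_self.trans ht₀.2), NNReal.dist_eq, NNReal.coe_sub h,
          sub_sub_cancel, hE, abs_of_nonneg (by positivity)]
  have hR : ∃ s, t₀ ≤ s ∧ dist t₀ s ≤ 2 * D ∧ (nndist (g 0) (g n) ≤ s ∨
      dist (c t₀) (c s) = 2 * D) := by
    have hd : dist t₀ (t₀ + E) = 2 * D := by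
      rw [NNReal.dist_eq, NNReal.coe_add, sub_add_cancel_left, abs_neg, hE,
        abs_of_nonneg (by positivity)]
    refine ⟨t₀ + E, le_self_add, hd.le, ?_⟩
    rcases le_total (nndist (g 0) (g n)) (t₀ + E) with h | h
    · exact .inl h
    · right
      rw [hc.isometric _ _ ht₀.2 h, hd]
  obtain ⟨a, ha, had, ha'⟩ := hL
  obtain ⟨b, hb, hbd, hb'⟩ := hR
  obtain ⟨j, hj, hj1, hj2⟩ := side a had (ha'.imp_right .inr)
  obtain ⟨k, hk, hk1, hk2⟩ := side b hbd (.inr hb')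
  have hzero : gromovProd (c t₀) (c a) (c b) = 0 := by
    apply gromovProd_eq_zero_of_between
    have hab : (min a (nndist (g 0) (g n)) : ℝ≥0) ≤ min t₀ (nndist (g 0) (g n)) :=
      min_le_min_right _ ha
    have hbb : (min t₀ (nndist (g 0) (g n)) : ℝ≥0) ≤ min b (nndist (g 0) (g n)) :=
      min_le_min_right _ hb
    have h1 : ((min a (nndist (g 0) (g n)) : ℝ≥0) : ℝ) ≤ (min t₀ (nndist (g 0) (g n)) : ℝ≥0) := hab
    have h2 : ((min t₀ (nndist (g 0) (g n)) : ℝ≥0) : ℝ) ≤ (min b (nndist (g 0) (g n)) : ℝ≥0) := hbb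
    rw [hc.dist_eq, hc.dist_eq, hc.dist_eq, NNReal.dist_eq, NNReal.dist_eq, NNReal.dist_eq,
      abs_of_nonpos (by linarith), abs_of_nonpos (by linarith), abs_of_nonpos (by linarith)]
    ring
  have hdjk : dist (g j) (g k) ≤ 6 * D := by
    have h1 := dist_triangle4 (g j) (c a) (c b) (g k)
    have h2 := dist_triangle_left (c a) (c b) (c t₀)
    have h3 := hc.dist_le t₀ a
    have h4 := hc.dist_le t₀ b
    rw [dist_comm (g j) (c a)] at h1
    linarith
  -- The quasigeodesic from `g j` to `g k` has at most `K * (6 * D) + K` steps and stays `D` away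
  -- from `c t₀`. Together with `side`, the product of `c a` and `c b` is then at least `D - K - m *
  -- δ - 2 * δ`, while it vanishes since `c t₀` lies between them.
  have hprod : D - K - m * δ ≤ gromovProd (c t₀) (g j) (g k) := by
    rcases lt_trichotomy j k with hjk | rfl | hjk
    · refine hX.gromovProd_quasiGeodesicSeq_ge hg hDle hjk hk ?_
      refine (hg.sub_le j k hjk.le hk).trans (le_trans ?_ hm)
      gcongr
    · have h1 := hDle j hj
      have h2 : (0 : ℝ) ≤ m * δ := by positivity
      simp only [gromovProd, dist_self]
      linarith
    · rw [gromovProd_comm]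
      refine hX.gromovProd_quasiGeodesicSeq_ge hg hDle hjk hj ?_
      refine (hg.sub_le k j hjk.le hj).trans (le_trans ?_ hm)
      rw [dist_comm]
      gcongr
  have f1 := hX.four_point (c t₀) (c a) (g j) (c b)
  have f2 := hX.four_point (c t₀) (g j) (g k) (c b)
  rw [gromovProd_comm _ (g k) (c b)] at f2
  have h2 : (0 : ℝ) ≤ m * δ := by positivity
  have f3 : D - K - m * δ - δ ≤ gromovProd (c t₀) (g j) (c b) := by
    have := le_min hprod (show D - K - m * δ ≤ _ by linarith : D - K - m * δ ≤
      gromovProd (c t₀) (c b) (g k))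
    linarith
  have := le_min (show D - K - m * δ - δ ≤ _ by linarith : _ ≤ gromovProd (c t₀) (c a) (g j)) f3
  linarith

/-- The Morse lemma, in terms of Gromov products. -/
theorem exists_gromovProd_quasiGeodesicSeq_le {δ K : ℝ} (hδ : 0 ≤ δ) (hK : 0 ≤ K) :
    ∃ M : ℝ, 0 ≤ M ∧ ∀ (X : Type u) [MetricSpace X], GromovHyperbolic δ X →
      ∀ (g : ℕ → X) (n : ℕ), IsQuasiGeodesicSeq K g n →
        (∀ m ≤ n, gromovProd (g m) (g 0) (g n) ≤ M) ∧
        ∀ p, ∃ j ≤ n, dist p (g j) ≤ gromovProd p (g 0) (g n) + M := by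
  obtain ⟨M₀, hM₀⟩ := exists_dist_quasiGeodesicSeq_le.{u} hδ hK
  set M := max M₀ 0
  have hM0 : 0 ≤ M := le_max_right _ _
  refine ⟨max (K * (K * (2 * M + 1) + K) + M) (M + 2 * δ), by positivity,
    fun X _ hX g n hg => ?_⟩
  obtain ⟨c, hc⟩ := hX.geodesic (g 0) (g n)
  have hM : ∀ t, ∃ j ≤ n, dist (c t) (g j) ≤ M := fun t =>
    (hM₀ X hX g n hg c hc t).imp fun j h => ⟨h.1, h.2.trans (le_max_left _ _)⟩
  constructor
  · intro m hm
    refine le_trans ?_ (le_max_left _ _)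
    -- Discrete connectedness: at the first integer time when the geodesic is near the part of `g`
    -- after `m`, it is also near the part before `m`. The two indices are then close to each other,
    -- hence to `m`.
    have hex : ∃ i : ℕ, ∃ j ≤ n, m ≤ j ∧ dist (c i) (g j) ≤ M := by
      obtain ⟨N, hN⟩ := exists_nat_ge (nndist (g 0) (g n))
      exact ⟨N, n, le_rfl, hm, by rw [hc.target _ hN, dist_self]; exact hM0⟩
    classical
    obtain ⟨i, ⟨j, hj, hmj, hd⟩, hmin⟩ : ∃ i : ℕ, (∃ j ≤ n, m ≤ j ∧ dist (c i) (g j) ≤ M) ∧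
        ∀ k < i, ¬ ∃ j ≤ n, m ≤ j ∧ dist (c k) (g j) ≤ M :=
      ⟨Nat.find hex, Nat.find_spec hex, fun k hk => Nat.find_min hex hk⟩
    have hprev : ∃ j' ≤ m, dist (c i) (g j') ≤ M + 1 := by
      rcases i with _ | i
      · refine ⟨0, Nat.zero_le m, ?_⟩
        rw [Nat.cast_zero, hc.source, dist_self]
        positivity
      · obtain ⟨j', hj', hd'⟩ := hM i
        refine ⟨j', ?_, ?_⟩
        · by_contra! h
          exact hmin i (Nat.lt_succ_self i) ⟨j', hj', h.le, hd'⟩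
        · have h1 := hc.dist_le (i + 1 : ℕ) i
          have h2 : dist ((i + 1 : ℕ) : ℝ≥0) i = 1 := by
            rw [NNReal.dist_eq]; push_cast; simp
          linarith [dist_triangle (c (i + 1 : ℕ)) (c i) (g j')]
    obtain ⟨j', hj'm, hd'⟩ := hprev
    have h1 : dist (g j') (g j) ≤ 2 * M + 1 := by
      linarith [dist_triangle_left (g j') (g j) (c i)]
    have h2 := hg.sub_le j' j (hj'm.trans hmj) hj
    have h3 := hg.dist_le hmj hj
    have h4 : (j' : ℝ) ≤ m := by exact_mod_cast hj'm
    have h5 := gromovProd_le_dist_of_between (w := g m) (hc.between (i : ℝ≥0))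
    have h6 := dist_triangle_right (g m) (c i) (g j)
    have h7 : K * dist (g j') (g j) ≤ K * (2 * M + 1) := by gcongr
    have h8 : K * ((j : ℝ) - m) ≤ K * (K * (2 * M + 1) + K) := by
      gcongr
      linarith
    linarith
  · intro p
    obtain ⟨t, -, -, ht⟩ := hX.exists_dist_le p hc
    obtain ⟨j, hj, hd⟩ := hM t
    refine ⟨j, hj, ?_⟩
    have := le_max_right (K * (K * (2 * M + 1) + K) + M) (M + 2 * δ)
    linarith [dist_triangle p (c t) (g j)]
open Filter Topology

/-! ### Maps at finite distance and quasi-isometric embeddings -/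

/-- The image of `f` lies in a bounded neighbourhood of the image of `g`. -/
def IsNear {A B X : Type*} [MetricSpace X] (f : A → X) (g : B → X) : Prop :=
  ∃ C : ℝ, ∀ a, ∃ b, dist (f a) (g b) ≤ C

theorem IsNear.trans {A B C X : Type*} [MetricSpace X] {f : A → X} {g : B → X} {k : C → X}
    (h : IsNear f g) (h' : IsNear g k) : IsNear f k := by
  obtain ⟨C, hC⟩ := h
  obtain ⟨C', hC'⟩ := h'
  refine ⟨C + C', fun a => ?_⟩
  obtain ⟨b, hb⟩ := hC a
  obtain ⟨c, hc⟩ := hC' b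
  exact ⟨c, (dist_triangle _ (g b) _).trans (add_le_add hb hc)⟩

theorem IsNear.of_hausdorffEDist {A B X : Type*} [MetricSpace X] {f : A → X} {g : B → X}
    (h : Metric.hausdorffEDist (Set.range f) (Set.range g) ≠ ⊤) : IsNear f g := by
  refine ⟨(Metric.hausdorffEDist (Set.range f) (Set.range g) + 1).toReal, fun a => ?_⟩
  obtain ⟨_, ⟨b, rfl⟩, hb⟩ := Metric.exists_edist_lt_of_hausdorffEDist_lt (Set.mem_range_self a)
    (ENNReal.lt_add_right h one_ne_zero)
  refine ⟨b, ?_⟩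
  rw [dist_edist]
  exact ENNReal.toReal_mono (ENNReal.add_ne_top.2 ⟨h, ENNReal.one_ne_top⟩) hb.le

theorem hausdorffEDist_range_ne_top_iff {A B X : Type*} [MetricSpace X] {f : A → X} {g : B → X} :
    Metric.hausdorffEDist (Set.range f) (Set.range g) ≠ ⊤ ↔ IsNear f g ∧ IsNear g f := by
  constructor
  · exact fun h => ⟨.of_hausdorffEDist h, .of_hausdorffEDist (by rwa [Metric.hausdorffEDist_comm])⟩
  · rintro ⟨⟨C, hC⟩, ⟨C', hC'⟩⟩
    refine ne_top_of_le_ne_top (ENNReal.ofReal_ne_top (r := max C C'))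
      (Metric.hausdorffEDist_le_of_mem_edist ?_ ?_)
    · rintro _ ⟨a, rfl⟩
      obtain ⟨b, hb⟩ := hC a
      exact ⟨_, ⟨b, rfl⟩, by
        rw [edist_dist]; exact ENNReal.ofReal_le_ofReal (hb.trans (le_max_left _ _))⟩
    · rintro _ ⟨a, rfl⟩
      obtain ⟨b, hb⟩ := hC' a
      exact ⟨_, ⟨b, rfl⟩, by
        rw [edist_dist]; exact ENNReal.ofReal_le_ofReal (hb.trans (le_max_right _ _))⟩

/-- Quasi-isometric embeddings, in a form without division. -/
def QuasiEmbedding {S X : Type*} [MetricSpace S] [MetricSpace X] (A : ℝ) (f : S → X) : Prop :=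
  ∀ s t, dist (f s) (f t) ≤ A * dist s t + A ∧ dist s t ≤ A * dist (f s) (f t) + A

namespace QuasiEmbedding

variable {S T X : Type*} [MetricSpace S] [MetricSpace T] [MetricSpace X] {A B : ℝ} {f : S → X}

theorem nonneg [Nonempty S] (h : QuasiEmbedding A f) : 0 ≤ A := by
  obtain ⟨s⟩ := ‹Nonempty S›
  simpa using (h s s).1

theorem mono [Nonempty S] (h : QuasiEmbedding A f) (hAB : A ≤ B) : QuasiEmbedding B f := by
  refine fun s t => ⟨(h s t).1.trans ?_, (h s t).2.trans ?_⟩ <;> gcongr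

theorem _root_.Isometry.quasiEmbedding (h : Isometry f) : QuasiEmbedding 1 f := fun s t => by
  rw [h.dist_eq]
  constructor <;> linarith

theorem comp_isometry (h : QuasiEmbedding A f) {g : T → S} (hg : Isometry g) :
    QuasiEmbedding A (f ∘ g) := fun s t => by
  simpa only [Function.comp_apply, hg.dist_eq] using h (g s) (g t)

theorem tendsto_dist {f : ℝ≥0 → X} (h : QuasiEmbedding A f) (z : X) :
    Tendsto (fun t => dist z (f t)) atTop atTop := by
  have hA : 0 ≤ A := h.nonneg
  rw [tendsto_atTop_atTop]
  intro b
  refine ⟨⟨max 0 (A * (|b| + dist z (f 0)) + A + 1), le_max_left _ _⟩, fun t ht => ?_⟩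
  have ht' : A * (|b| + dist z (f 0)) + A + 1 ≤ (t : ℝ) := (le_max_right _ _).trans ht
  have h1 := (h 0 t).2
  rw [NNReal.dist_eq, NNReal.coe_zero, zero_sub, abs_neg, abs_of_nonneg t.coe_nonneg] at h1
  by_contra! hlt
  have h2 : dist (f 0) (f t) ≤ |b| + dist z (f 0) := by
    linarith [dist_triangle_left (f 0) (f t) z, le_abs_self b]
  have : A * dist (f 0) (f t) ≤ A * (|b| + dist z (f 0)) := by gcongr
  linarith

theorem exists_dist_le {f : ℝ≥0 → X} (h : QuasiEmbedding A f) (z : X) (T : ℝ≥0) :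
    ∃ R, ∀ t ≤ T, dist z (f t) ≤ R := by
  have hA : 0 ≤ A := h.nonneg
  refine ⟨dist z (f 0) + (A * T + A), fun t ht => ?_⟩
  have h1 := (h 0 t).1
  rw [NNReal.dist_eq, NNReal.coe_zero, zero_sub, abs_neg, abs_of_nonneg t.coe_nonneg] at h1
  have : A * (t : ℝ) ≤ A * T := by gcongr
  linarith [dist_triangle z (f 0) (f t)]

/-- The times `τ n` on `g` of points near `f n` make jumps of at most `J` and are unbounded, so
every time `t` beyond `τ 0` is within `J` of one of them. Thus one-sided nearness decides equality
of endpoints. -/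
theorem isNear_symm {f g : ℝ≥0 → X} (hf : QuasiEmbedding A f) (hg : QuasiEmbedding B g)
    (h : IsNear f g) : IsNear g f := by
  have hA : 0 ≤ A := hf.nonneg
  have hB : 0 ≤ B := hg.nonneg
  obtain ⟨C, hC⟩ := h
  choose τ hτ using hC
  have hC0 : 0 ≤ C := dist_nonneg.trans (hτ 0)
  set J : ℝ := B * (2 * C + 2 * A) + B with hJ
  have hJ0 : 0 ≤ J := by positivity
  have hstep : ∀ n : ℕ, (τ (n + 1 : ℕ) : ℝ) ≤ τ n + J := by
    intro n
    have h1 := (hg (τ n) (τ (n + 1 : ℕ))).2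
    have h2 := (hf n (n + 1 : ℕ)).1
    have h3 : dist (n : ℝ≥0) ((n + 1 : ℕ) : ℝ≥0) = 1 := by
      rw [NNReal.dist_eq]; push_cast; simp
    rw [h3] at h2
    have h4 : dist (g (τ n)) (g (τ (n + 1 : ℕ))) ≤ 2 * C + 2 * A := by
      linarith [dist_triangle4 (g (τ n)) (f n) (f (n + 1 : ℕ)) (g (τ (n + 1 : ℕ))), hτ n,
        hτ (n + 1 : ℕ), dist_comm (g (τ n)) (f n)]
    have h5 : B * dist (g (τ n)) (g (τ (n + 1 : ℕ))) ≤ B * (2 * C + 2 * A) := by gcongr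
    have h6 : (τ (n + 1 : ℕ) : ℝ) - τ n ≤ dist (τ n) (τ (n + 1 : ℕ)) := by
      rw [dist_comm, NNReal.dist_eq]
      exact le_abs_self _
    linarith
  refine ⟨max (B * J + B + C) (B * τ 0 + B + C), fun t => ?_⟩
  have near : ∀ (s : ℝ≥0) (D : ℝ), dist t (τ s) ≤ D → dist (g t) (f s) ≤ B * D + B + C := by
    intro s D hD
    have h1 := (hg t (τ s)).1
    have h2 : B * dist t (τ s) ≤ B * D := by gcongr
    linarith [dist_triangle_right (g t) (f s) (g (τ s)), hτ s]
  by_cases h0 : t ≤ τ 0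
  · refine ⟨0, (near 0 (τ 0) ?_).trans (le_max_right _ _)⟩
    have : (t : ℝ) ≤ τ 0 := h0
    rw [NNReal.dist_eq, abs_of_nonpos (by linarith)]
    linarith [t.coe_nonneg]
  · have hex : ∃ n : ℕ, t ≤ τ n := by
      obtain ⟨T, hT⟩ := hg.exists_dist_le (f 0) t
      obtain ⟨S, hS⟩ := tendsto_atTop_atTop.1 (hf.tendsto_dist (f 0)) (T + C + 1)
      obtain ⟨n, hn⟩ := exists_nat_ge S
      refine ⟨n, ?_⟩
      by_contra! hlt
      have h1 := hT _ hlt.le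
      have h2 := hS n hn
      linarith [dist_triangle_right (f 0) (f n) (g (τ n)), hτ n]
    classical
    obtain ⟨n, hn, hmin⟩ : ∃ n : ℕ, t ≤ τ n ∧ ∀ k < n, ¬ t ≤ τ k :=
      ⟨Nat.find hex, Nat.find_spec hex, fun k hk => Nat.find_min hex hk⟩
    rcases n with _ | k
    · exact absurd (by simpa using hn) h0
    · have hk := not_le.1 (hmin k (Nat.lt_succ_self k))
      refine ⟨k, (near k J ?_).trans (le_max_left _ _)⟩
      have h1 : (τ k : ℝ) < t := hk
      have h2 : (t : ℝ) ≤ τ (k + 1 : ℕ) := hn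
      rw [NNReal.dist_eq, abs_of_nonneg (by linarith)]
      linarith [hstep k]

end QuasiEmbedding

section Rays

variable {X : Type u} [MetricSpace X]

theorem GeodesicRay.quasiEmbedding (α : GeodesicRay X) : QuasiEmbedding 1 α.1 :=
  α.2.quasiEmbedding

theorem GeodesicRay.endpoint_eq_iff {α β : GeodesicRay X} :
    α.endpoint = β.endpoint ↔ IsNear α.1 β.1 := by
  refine (Quotient.eq (r := raySetoid X)).trans ?_
  change Metric.hausdorffEDist (Set.range α.1) (Set.range β.1) ≠ ⊤ ↔ _
  rw [hausdorffEDist_range_ne_top_iff]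
  exact ⟨fun h => h.1, fun h => ⟨h, α.quasiEmbedding.isNear_symm β.quasiEmbedding h⟩⟩

theorem GeodesicBoundary.exists_ray (ξ : GeodesicBoundary X) :
    ∃ α : GeodesicRay X, α.endpoint = ξ := Quotient.exists_rep ξ

theorem QuasiEmbedding.endsAt_endpoint {A : ℝ} {γ : ℝ≥0 → X} (hγ : QuasiEmbedding A γ)
    {α : GeodesicRay X} (h : IsNear γ α.1) : EndsAt γ α.endpoint :=
  ⟨α, rfl, hausdorffEDist_range_ne_top_iff.2 ⟨h, hγ.isNear_symm α.quasiEmbedding h⟩⟩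

theorem EndsAt.isNear {γ : ℝ≥0 → X} {α : GeodesicRay X} (h : EndsAt γ α.endpoint) :
    IsNear γ α.1 := by
  obtain ⟨β, hβ, h⟩ := h
  exact (hausdorffEDist_range_ne_top_iff.1 h).1.trans (GeodesicRay.endpoint_eq_iff.1 hβ)

theorem EndsAt.isNear_symm {γ : ℝ≥0 → X} {α : GeodesicRay X} (h : EndsAt γ α.endpoint) :
    IsNear α.1 γ := by
  obtain ⟨β, hβ, h⟩ := h
  exact (GeodesicRay.endpoint_eq_iff.1 hβ.symm).trans (hausdorffEDist_range_ne_top_iff.1 h).2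

theorem EndsAt.unique {γ : ℝ≥0 → X} {ξ η : GeodesicBoundary X} (h : EndsAt γ ξ)
    (h' : EndsAt γ η) : ξ = η := by
  obtain ⟨α, rfl⟩ := ξ.exists_ray
  obtain ⟨β, rfl⟩ := η.exists_ray
  exact GeodesicRay.endpoint_eq_iff.2 (h.isNear_symm.trans h'.isNear)

theorem GeodesicRay.dist_zero (β : GeodesicRay X) (t : ℝ≥0) : dist (β.1 0) (β.1 t) = t := by
  rw [β.2.dist_eq, NNReal.dist_eq, NNReal.coe_zero, zero_sub, abs_neg,
    abs_of_nonneg t.coe_nonneg]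

theorem GeodesicRay.between (β : GeodesicRay X) {s t : ℝ≥0} (h : s ≤ t) :
    dist (β.1 0) (β.1 s) + dist (β.1 s) (β.1 t) = dist (β.1 0) (β.1 t) := by
  have h' : (s : ℝ) ≤ t := h
  rw [β.dist_zero, β.dist_zero, β.2.dist_eq, NNReal.dist_eq, abs_of_nonpos (by linarith)]
  ring

variable {δ : ℝ}

namespace GromovHyperbolic

variable (hX : GromovHyperbolic δ X)
include hX

theorem exists_dist_ray_le {w : X} {β : GeodesicRay X} {t : ℝ≥0} {E : ℝ}
    (h : gromovProd w (β.1 0) (β.1 t) ≤ E) :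
    ∃ r : ℝ≥0, r ≤ t ∧ (r : ℝ) ≤ dist (β.1 0) w ∧ dist w (β.1 r) ≤ E + 2 * δ := by
  let r : ℝ≥0 := ⟨gromovProd (β.1 0) w (β.1 t), gromovProd_nonneg _ _ _⟩
  have hr : (r : ℝ) = gromovProd (β.1 0) w (β.1 t) := rfl
  have hrt : r ≤ t := by
    have := gromovProd_le_dist_right (β.1 0) w (β.1 t)
    rw [β.dist_zero, ← hr] at this
    exact this
  refine ⟨r, hrt, gromovProd_le_dist _ _ _, ?_⟩
  have := hX.dist_le_of_between w (β.between hrt) (by rw [β.dist_zero, hr])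
  linarith

/-- If `w` is close to a geodesic from `u` to `v`, and `v` is close to infinity on a ray `β`
as seen from `w`, then `w` is close to `β`. -/
theorem exists_dist_ray_le_of_lt {w u v : X} {β : GeodesicRay X} {t : ℝ≥0} {M : ℝ}
    (h : gromovProd w u v ≤ M) (h' : M + δ < gromovProd w v (β.1 t)) :
    ∃ r : ℝ≥0, (r : ℝ) ≤ dist (β.1 0) w ∧ dist w (β.1 r) ≤ M + dist u (β.1 0) + 3 * δ := by
  have h1 : gromovProd w u (β.1 t) ≤ M + δ := by
    refine hX.gromovProd_le_of_lt h ?_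
    rwa [gromovProd_comm]
  have h2 := gromovProd_le_left w (β.1 0) u (β.1 t)
  obtain ⟨r, -, hr, hd⟩ := hX.exists_dist_ray_le (h2.trans (add_le_add_left h1 _))
  refine ⟨r, hr, ?_⟩
  rw [dist_comm u]
  linarith

end GromovHyperbolic

end Rays

/-- The Morse lemma for quasigeodesic rays. -/
theorem exists_gromovProd_quasiEmbedding_le {δ A : ℝ} (hδ : 0 ≤ δ) (hA : 0 ≤ A) :
    ∃ M : ℝ, 0 ≤ M ∧ ∀ (X : Type u) [MetricSpace X], GromovHyperbolic δ X →
      ∀ f : ℝ≥0 → X, QuasiEmbedding A f →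
        ∀ s t, s ≤ t → gromovProd (f s) (f 0) (f t) ≤ M := by
  obtain ⟨M, hM0, hM⟩ := exists_gromovProd_quasiGeodesicSeq_le.{u} hδ (mul_nonneg zero_le_two hA)
  refine ⟨M + 4 * A, by positivity, fun X _ hX f hf s t hst => ?_⟩
  have hg : IsQuasiGeodesicSeq (2 * A) (fun i : ℕ => f i) ⌊t⌋₊ := by
    constructor
    · intro i _
      have := (hf i (i + 1 : ℕ)).1
      have h3 : dist (i : ℝ≥0) ((i + 1 : ℕ) : ℝ≥0) = 1 := by
        rw [NNReal.dist_eq]; push_cast; simp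
      rw [h3] at this
      linarith
    · intro i j hij _
      have h1 := (hf i j).2
      have h2 : (j : ℝ) - i ≤ dist (i : ℝ≥0) (j : ℝ≥0) := by
        rw [dist_comm, NNReal.dist_eq]
        exact le_abs_self _
      have : 0 ≤ A * dist (f i) (f j) := by positivity
      linarith
  have hfl : ∀ r : ℝ≥0, dist (f r) (f ⌊r⌋₊) ≤ 2 * A := by
    intro r
    have h1 := (hf r ⌊r⌋₊).1
    have h2 : dist r (⌊r⌋₊ : ℝ≥0) ≤ 1 := by
      have h3 : ((⌊r⌋₊ : ℝ≥0) : ℝ) ≤ r := Nat.floor_le r.2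
      have h4 : (r : ℝ) < (⌊r⌋₊ : ℝ≥0) + 1 := Nat.lt_floor_add_one r
      rw [NNReal.dist_eq, abs_of_nonneg (by linarith)]
      linarith
    have : A * dist r (⌊r⌋₊ : ℝ≥0) ≤ A * 1 := by gcongr
    linarith
  have h := (hM X hX _ _ hg).1 ⌊s⌋₊ (Nat.floor_mono hst)
  simp only [Nat.cast_zero] at h
  have h1 := gromovProd_le_base (f s) (f ⌊s⌋₊) (f 0) (f t)
  have h2 := gromovProd_le_right (f ⌊s⌋₊) (f 0) (f t) (f ⌊t⌋₊)
  linarith [hfl s, hfl t]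

/-! ### Limits along ultrafilters -/

theorem Ultrafilter.exists_tendsto_of_isCompact {ι X : Type*} [TopologicalSpace X]
    (U : Ultrafilter ι) {g : ι → X} {C : Set X} (hC : IsCompact C) (h : ∀ᶠ n in U, g n ∈ C) :
    ∃ x ∈ C, Tendsto g U (𝓝 x) := by
  obtain ⟨x, hx, hle⟩ := isCompact_iff_ultrafilter_le_nhds.1 hC (U.map g) (by
    rw [le_principal_iff]
    exact h)
  exact ⟨x, hx, hle⟩

/-- A substitute for Arzelà–Ascoli: along an ultrafilter, pointwise relative compactness yields a
limit at all times simultaneously, without extracting subsequences. -/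
theorem Ultrafilter.exists_isometry_tendsto {ι S X : Type*} [MetricSpace S] [MetricSpace X]
    (U : Ultrafilter ι) {c : ι → S → X} (hC : ∀ s, ∃ C, IsCompact C ∧ ∀ᶠ n in U, c n s ∈ C)
    (hd : ∀ s t, ∀ᶠ n in U, dist (c n s) (c n t) = dist s t) :
    ∃ α : S → X, Isometry α ∧ ∀ s, Tendsto (fun n => c n s) U (𝓝 (α s)) := by
  have : ∀ s, ∃ x, Tendsto (fun n => c n s) U (𝓝 x) := fun s => by
    obtain ⟨C, hC, h⟩ := hC s
    obtain ⟨x, -, hx⟩ := U.exists_tendsto_of_isCompact hC h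
    exact ⟨x, hx⟩
  choose α hα using this
  refine ⟨α, Isometry.of_dist_eq fun s t => ?_, hα⟩
  exact tendsto_nhds_unique ((hα s).dist (hα t))
    (tendsto_const_nhds.congr' ((hd s t).mono fun _ h => h.symm))

theorem eventually_forall_dist_le_of_lipschitz {ι X : Type*} [MetricSpace X] {l : Filter ι}
    {c : ι → ℝ≥0 → X} {α : ℝ≥0 → X} (hc : ∀ n, LipschitzWith 1 (c n)) (hα : LipschitzWith 1 α)
    (h : ∀ s, Tendsto (fun n => c n s) l (𝓝 (α s))) (T : ℝ≥0) {ε : ℝ} (hε : 0 < ε) :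
    ∀ᶠ n in l, ∀ s ≤ T, dist (α s) (c n s) < ε := by
  obtain ⟨N, -, hN, hcov⟩ := (isCompact_Icc (a := (0 : ℝ≥0)) (b := T)).finite_cover_balls
    (show 0 < ε / 3 by positivity)
  have h1 : ∀ᶠ n in l, ∀ r ∈ N, dist (c n r) (α r) < ε / 3 :=
    (eventually_all_finite hN).2 fun r _ => (Metric.tendsto_nhds.1 (h r)) _ (by positivity)
  filter_upwards [h1] with n hn s hs
  obtain ⟨r, hr, hsr⟩ := Set.mem_iUnion₂.1 (hcov ⟨zero_le, hs⟩)
  have h2 := hn r hr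
  have h3 := (hc n).dist_le_mul s r
  have h4 := hα.dist_le_mul s r
  rw [Metric.mem_ball] at hsr
  simp only [NNReal.coe_one, one_mul] at h3 h4
  have h5 := dist_triangle4 (α s) (α r) (c n r) (c n s)
  rw [dist_comm] at h2
  rw [dist_comm] at h3
  linarith

/-! ### Spaces with enough limits of geodesic segments -/

/-- Geodesic segments from any point to the points of `V` can be chosen such that, at any time,
they remain in a compact set. -/
def HasCompactGeodesics {X : Type u} [MetricSpace X] (V : Set X) : Prop :=
  ∀ p : X, ∃ c : X → ℝ≥0 → X, (∀ v ∈ V, IsGeodesicSegment (c v) p v) ∧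
    ∀ s, ∃ C, IsCompact C ∧ ∀ v ∈ V, c v s ∈ C

theorem GromovHyperbolic.hasCompactGeodesics_univ {X : Type u} [MetricSpace X] [ProperSpace X]
    {δ : ℝ} (hX : GromovHyperbolic δ X) : HasCompactGeodesics (Set.univ : Set X) := by
  intro p
  choose c hc using hX.geodesic p
  refine ⟨c, fun v _ => hc v, fun s => ⟨_, isCompact_closedBall p s, fun v _ => ?_⟩⟩
  rw [Metric.mem_closedBall, dist_comm, (hc v).dist_source]
  exact min_le_left _ _

/-- The ray is a limit of geodesics from `p` to points of `V` near `f n`. By the Morse lemma they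
pass uniformly close to `f s`, at times bounded by the distance from `p` to `f s`, so this survives
in the limit. -/
theorem exists_ray_isNear {δ A : ℝ} (hδ : 0 ≤ δ) (hA : 0 ≤ A) :
    ∃ M : ℝ, 0 ≤ M ∧ ∀ (X : Type u) [MetricSpace X], GromovHyperbolic δ X → ∀ V : Set X,
      HasCompactGeodesics V → (∀ x, ∃ v ∈ V, dist x v ≤ 1) → ∀ f : ℝ≥0 → X, QuasiEmbedding A f →
        ∀ p, ∃ α : GeodesicRay X, α.1 0 = p ∧ ∀ s, ∃ t, dist (f s) (α.1 t) ≤ M + dist p (f 0) := by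
  obtain ⟨M, hM0, hM⟩ := exists_gromovProd_quasiEmbedding_le.{u} hδ hA
  refine ⟨M + 1 + 2 * δ, by positivity, fun X _ hX V hV hV1 f hf p => ?_⟩
  obtain ⟨geo, hgeo, hcomp⟩ := hV p
  choose a haV ha using fun n : ℕ => hV1 (f n)
  let U := hyperfilter ℕ
  have hU : (U : Filter ℕ) ≤ atTop := Nat.hyperfilter_le_atTop
  have hlarge : ∀ T : ℝ≥0, ∀ᶠ n in (U : Filter ℕ), T ≤ nndist p (a n) := by
    intro T
    have h1 : Tendsto (fun n : ℕ => dist p (f n)) atTop atTop :=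
      (hf.tendsto_dist p).comp tendsto_natCast_atTop_atTop
    filter_upwards [hU (h1.eventually_ge_atTop (T + 1))] with n hn
    have : (T : ℝ) ≤ dist p (a n) := by
      linarith [dist_triangle_right p (f n) (a n), ha n]
    exact this
  obtain ⟨α, hα, hlim⟩ := U.exists_isometry_tendsto (c := fun n => geo (a n))
    (fun s => (hcomp s).imp fun C h => ⟨h.1, Eventually.of_forall fun n => h.2 _ (haV n)⟩)
    (fun s t => by
      filter_upwards [hlarge s, hlarge t] with n h1 h2
      exact (hgeo _ (haV n)).isometric s t h1 h2)
  refine ⟨⟨α, hα⟩, ?_, fun s => ?_⟩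
  · refine tendsto_nhds_unique (hlim 0) (tendsto_const_nhds.congr fun n => ?_)
    exact (hgeo _ (haV n)).source.symm
  · have h1 : ∀ᶠ n in (U : Filter ℕ), ∃ t : ℝ≥0, t ≤ nndist p (f s) ∧
        dist (f s) (geo (a n) t) ≤ M + 1 + 2 * δ + dist p (f 0) := by
      have h2 : ∀ᶠ n : ℕ in atTop, s ≤ n := tendsto_natCast_atTop_atTop.eventually_ge_atTop s
      filter_upwards [hU h2] with n hn
      have h3 := hM X hX f hf s n hn
      have h4 := gromovProd_le_left (f s) p (f 0) (a n)
      have h5 := gromovProd_le_right (f s) (f 0) (a n) (f n)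
      rw [dist_comm (a n)] at h5
      obtain ⟨t, ht, -, hd⟩ := hX.exists_dist_le (f s) (hgeo _ (haV n))
      exact ⟨t, ht, by linarith [ha n]⟩
    -- A suitable time exists for almost all `n` only; other values do not matter for the limit.
    let τ : ℕ → ℝ≥0 := fun n => Classical.epsilon fun t : ℝ≥0 => t ≤ nndist p (f s) ∧
        dist (f s) (geo (a n) t) ≤ M + 1 + 2 * δ + dist p (f 0)
    have h2 : ∀ᶠ n in (U : Filter ℕ), τ n ≤ nndist p (f s) ∧
        dist (f s) (geo (a n) (τ n)) ≤ M + 1 + 2 * δ + dist p (f 0) :=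
      h1.mono fun n hn => Classical.epsilon_spec hn
    obtain ⟨t, -, ht⟩ := U.exists_tendsto_of_isCompact (g := τ)
      (isCompact_Icc (a := 0) (b := nndist p (f s))) (h2.mono fun n hn => ⟨zero_le, hn.1⟩)
    refine ⟨t, ?_⟩
    have h3 : Tendsto (fun n => M + 1 + 2 * δ + dist p (f 0) + dist (τ n) t) U
        (𝓝 (M + 1 + 2 * δ + dist p (f 0) + 0)) :=
      tendsto_const_nhds.add (tendsto_iff_dist_tendsto_zero.1 ht)
    rw [add_zero] at h3
    refine le_of_tendsto_of_tendsto (tendsto_const_nhds.dist (hlim t)) h3 ?_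
    filter_upwards [h2] with n hn
    exact (dist_triangle _ _ _).trans
      (add_le_add hn.2 ((hgeo _ (haV n)).dist_le (τ n) t))

/-- A limit `β` of geodesics from `p` to the `a n` ends at `α.endpoint`: a point of such a geodesic
sees `a n` and `α.1 n` in the same direction once their product is large, so it is close to `α`. -/
theorem GromovHyperbolic.convergesToBoundary {X : Type u} [MetricSpace X] {δ : ℝ}
    (hX : GromovHyperbolic δ X) {V : Set X} (hV : HasCompactGeodesics V) {a : ℕ → X}
    (ha : ∀ n, a n ∈ V) {α : GeodesicRay X}
    (h : Tendsto (fun n : ℕ => gromovProd (α.1 0) (a n) (α.1 n)) atTop atTop) :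
    ConvergesToBoundary a α.endpoint := by
  intro p
  obtain ⟨geo, hgeo, hcomp⟩ := hV p
  refine ⟨fun n => geo (a n), fun n => hgeo _ (ha n), fun m hm => ?_⟩
  let U := hyperfilter ℕ
  have hU : (U : Filter ℕ) ≤ atTop := Nat.hyperfilter_le_atTop
  have hlarge : ∀ T : ℝ≥0, ∀ᶠ n in (U : Filter ℕ), T ≤ nndist p (a (m n)) := by
    intro T
    filter_upwards [hU ((h.comp hm.tendsto_atTop).eventually_ge_atTop (T + dist p (α.1 0)))]
      with n hn
    have h1 := gromovProd_le_dist (α.1 0) (a (m n)) (α.1 (m n))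
    have h2 := dist_triangle_left (α.1 0) (a (m n)) p
    have : (T : ℝ) ≤ dist p (a (m n)) := by
      simp only [Function.comp_apply] at hn
      linarith
    exact this
  obtain ⟨β, hβ, hlim⟩ := U.exists_isometry_tendsto (c := fun n => geo (a (m n)))
    (fun s => (hcomp s).imp fun C h => ⟨h.1, Eventually.of_forall fun n => h.2 _ (ha _)⟩)
    (fun s t => by
      filter_upwards [hlarge s, hlarge t] with n h1 h2
      exact (hgeo _ (ha _)).isometric s t h1 h2)
  have hunif : ∀ (T : ℝ≥0) (ε : ℝ), 0 < ε →
      ∀ᶠ n in (U : Filter ℕ), ∀ s ≤ T, dist (β s) (geo (a (m n)) s) < ε := fun T ε hε =>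
    eventually_forall_dist_le_of_lipschitz (fun n => (hgeo _ (ha _)).lipschitzWith) hβ.lipschitz
      hlim T hε
  -- Diagonal choice: the `j`-th selected segment is `1 / (j + 1)`-close to `β` on `[0, j]`, so one
  -- subsequence serves every compact interval.
  obtain ⟨l, hl, hl'⟩ := extraction_forall_of_frequently
    (P := fun j n => ∀ s ≤ (j : ℝ≥0), dist (β s) (geo (a (m n)) s) < 1 / ((j : ℝ) + 1))
    fun j => ((hunif j _ (by positivity)).frequently).filter_mono hU
  let β' : GeodesicRay X := ⟨β, hβ⟩
  refine ⟨l, hl, β', ?_, ?_, fun T => ?_⟩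
  · refine tendsto_nhds_unique (hlim 0) (tendsto_const_nhds.congr fun n => ?_)
    exact (hgeo _ (ha _)).source.symm
  · refine GeodesicRay.endpoint_eq_iff.2 ⟨1 + (0 + dist p (α.1 0) + 3 * δ), fun s => ?_⟩
    have h1 : ∀ᶠ n in (U : Filter ℕ),
        δ + dist p (α.1 0) + s < gromovProd (α.1 0) (a (m n)) (α.1 (m n)) :=
      hU ((h.comp hm.tendsto_atTop).eventually_gt_atTop _)
    obtain ⟨n, hn, hn'⟩ := (h1.and (hunif s 1 one_pos)).exists
    have h2 := hn' s le_rfl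
    set w := geo (a (m n)) s with hw
    have h3 : gromovProd w p (a (m n)) ≤ 0 :=
      (gromovProd_eq_zero_of_between ((hgeo _ (ha _)).between s)).le
    have h4 := (hgeo _ (ha (m n))).dist_source s
    have h5 := min_le_left (s : ℝ) (dist p (a (m n)))
    have h6 := gromovProd_le_base (α.1 0) w (a (m n)) (α.1 (m n))
    have h7 := dist_triangle_left (α.1 0) w p
    obtain ⟨r, -, hr⟩ := hX.exists_dist_ray_le_of_lt (t := (m n : ℝ≥0)) h3 (by linarith)
    exact ⟨r, (dist_triangle _ w _).trans (add_le_add h2.le hr)⟩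
  · rw [Metric.tendstoUniformlyOn_iff]
    intro ε hε
    obtain ⟨N, hN⟩ := exists_nat_ge T
    obtain ⟨N', hN'⟩ := exists_nat_one_div_lt hε
    filter_upwards [eventually_ge_atTop (max N N')] with k hk s hs
    have h1 : N ≤ k := (le_max_left _ _).trans hk
    have h2 : N' ≤ k := (le_max_right _ _).trans hk
    refine (hl' k s (hs.2.trans (hN.trans (by exact_mod_cast h1)))).trans_le
      (le_trans ?_ hN'.le)
    have : (N' : ℝ) ≤ k := by exact_mod_cast h2
    gcongr

/-- Quasigeodesic rays stay uniformly close to the geodesic rays with the same end point. -/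
theorem exists_dist_ray_le_of_isNear {δ A : ℝ} (hδ : 0 ≤ δ) (hA : 0 ≤ A) :
    ∃ M : ℝ, 0 ≤ M ∧ ∀ (X : Type u) [MetricSpace X], GromovHyperbolic δ X → ∀ f : ℝ≥0 → X,
      QuasiEmbedding A f → ∀ β : GeodesicRay X, IsNear f β.1 →
        ∀ s, ∃ t, dist (f s) (β.1 t) ≤ M + dist (f 0) (β.1 0) := by
  obtain ⟨M, hM0, hM⟩ := exists_gromovProd_quasiEmbedding_le.{u} hδ hA
  refine ⟨M + 3 * δ, by positivity, fun X _ hX f hf β ⟨C, hC⟩ s => ?_⟩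
  obtain ⟨n, hn⟩ := ((eventually_ge_atTop s).and
    ((hf.tendsto_dist (f s)).eventually_gt_atTop (M + δ + C))).exists
  obtain ⟨t, ht⟩ := hC n
  have h1 := dist_sub_dist_le_gromovProd (f s) (f n) (β.1 t)
  obtain ⟨r, -, hr⟩ := hX.exists_dist_ray_le_of_lt (hM X hX f hf s n hn.1) (by linarith)
  exact ⟨r, by linarith⟩

/-! ### Gromov products of rays -/

section EventualBounds

variable {X : Type u} [MetricSpace X] {δ A A' D D' : ℝ} {z : X} {f f' g g' : ℝ≥0 → X}

/-- The Gromov products of far away points of `f` and `g` are bounded by `D`. -/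
def EventuallyProdLE (D : ℝ) (z : X) (f g : ℝ≥0 → X) : Prop :=
  ∃ S : ℝ≥0, ∀ s, S ≤ s → ∀ t, S ≤ t → gromovProd z (f s) (g t) ≤ D

theorem EventuallyProdLE.symm (h : EventuallyProdLE D z f g) : EventuallyProdLE D z g f := by
  obtain ⟨S, hS⟩ := h
  exact ⟨S, fun s hs t ht => by rw [gromovProd_comm]; exact hS t ht s hs⟩

theorem EventuallyProdLE.mono (h : EventuallyProdLE D z f g) (hD : D ≤ D') :
    EventuallyProdLE D' z f g := by
  obtain ⟨S, hS⟩ := h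
  exact ⟨S, fun s hs t ht => (hS s hs t ht).trans hD⟩

theorem EventuallyProdLE.eventually (h : EventuallyProdLE D z f g) :
    ∀ᶠ s in atTop, gromovProd z (f s) (g s) ≤ D := by
  obtain ⟨S, hS⟩ := h
  exact (eventually_ge_atTop S).mono fun s hs => hS s hs s hs

/-- Far out, `f' s` is close to a far point of `f`, and their product at `z` is large; the four
point condition then transfers the bound at the cost of `δ`, however far `f'` is from `f`. -/
theorem EventuallyProdLE.of_isNear_left (hX : GromovHyperbolic δ X) (hf : QuasiEmbedding A f)
    (hf' : QuasiEmbedding A' f') (hn : IsNear f' f) (h : EventuallyProdLE D z f g) :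
    EventuallyProdLE (D + δ) z f' g := by
  obtain ⟨S, hS⟩ := h
  obtain ⟨C, hC⟩ := hn
  obtain ⟨R, hR⟩ := hf.exists_dist_le z S
  obtain ⟨T, hT⟩ := eventually_atTop.1
    ((hf'.tendsto_dist z).eventually_gt_atTop (max (R + C) (D + δ + C)))
  refine ⟨max S T, fun s hs t ht => ?_⟩
  obtain ⟨r, hr⟩ := hC s
  have h1 := hT s ((le_max_right _ _).trans hs)
  have hrS : S ≤ r := by
    by_contra! hlt
    have h2 := hR r hlt.le
    have h3 := dist_triangle_right z (f' s) (f r)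
    have h4 := le_max_left (R + C) (D + δ + C)
    linarith
  have h5 := hS r hrS t ((le_max_left _ _).trans ht)
  have h6 := dist_sub_dist_le_gromovProd z (f' s) (f r)
  have h7 := le_max_right (R + C) (D + δ + C)
  rw [gromovProd_comm] at h5 ⊢
  exact hX.gromovProd_le_of_lt h5 (by linarith)

theorem EventuallyProdLE.of_isNear (hX : GromovHyperbolic δ X) (hf : QuasiEmbedding A f)
    (hf' : QuasiEmbedding A f') (hn : IsNear f' f) (hg : QuasiEmbedding A' g)
    (hg' : QuasiEmbedding A' g') (hn' : IsNear g' g) (h : EventuallyProdLE D z f g) :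
    EventuallyProdLE (D + 2 * δ) z f' g' := by
  have := ((h.of_isNear_left hX hf hf' hn).symm.of_isNear_left hX hg hg' hn').symm
  exact this.mono (by linarith)

/-- If the products were unbounded, each point of `α` would be uniformly close to `β`, since far
points of both rays lie in the same direction from it. -/
theorem GromovHyperbolic.exists_eventuallyProdLE (hX : GromovHyperbolic δ X)
    {α β : GeodesicRay X} (h : α.endpoint ≠ β.endpoint) (p : X) :
    ∃ E, EventuallyProdLE E p α.1 β.1 := by
  by_contra! hE
  refine h (GeodesicRay.endpoint_eq_iff.2 ⟨0 + dist (α.1 0) (β.1 0) + 3 * δ, fun r => ?_⟩)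
  have h1 := hE (δ + dist p (α.1 r))
  simp only [EventuallyProdLE, not_exists, not_forall, not_le] at h1
  obtain ⟨s, hs, t, -, hlt⟩ := h1 r
  have h2 : gromovProd (α.1 r) (α.1 0) (α.1 s) ≤ 0 :=
    (gromovProd_eq_zero_of_between (α.between hs)).le
  have h3 := gromovProd_le_base p (α.1 r) (α.1 s) (β.1 t)
  obtain ⟨t', -, ht'⟩ := hX.exists_dist_ray_le_of_lt h2 (by linarith)
  exact ⟨t', ht'⟩

end EventualBounds

/-! ### Centers of ideal triangles -/

section Centers

variable {X : Type u} [MetricSpace X] {δ D D' : ℝ} {z z' : X} {ξ : BoundaryTriple X}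

/-- `z` is a `D`-center of the ideal triangle `ξ`, in terms of Gromov products. -/
def IsCenter (D : ℝ) (z : X) (ξ : BoundaryTriple X) : Prop :=
  ∀ a b, a ≠ b → ∀ α β : GeodesicRay X, α.endpoint = ξ.1 a → β.endpoint = ξ.1 b →
    EventuallyProdLE D z α.1 β.1

/-- One choice of representing rays suffices, up to `2 * δ`. -/
theorem isCenter_of_rays (hX : GromovHyperbolic δ X) {α : Fin 3 → GeodesicRay X}
    (hα : ∀ a, (α a).endpoint = ξ.1 a)
    (h : ∀ a b, a ≠ b → EventuallyProdLE D z (α a).1 (α b).1) : IsCenter (D + 2 * δ) z ξ :=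
  fun a b hab α' β' hα' hβ' => (h a b hab).of_isNear hX (α a).quasiEmbedding α'.quasiEmbedding
    (GeodesicRay.endpoint_eq_iff.1 (hα'.trans (hα a).symm)) (α b).quasiEmbedding β'.quasiEmbedding
    (GeodesicRay.endpoint_eq_iff.1 (hβ'.trans (hα b).symm))

theorem BoundaryTriple.exists_rays (ξ : BoundaryTriple X) :
    ∃ α : Fin 3 → GeodesicRay X, ∀ a, (α a).endpoint = ξ.1 a := by
  choose α hα using fun a => (ξ.1 a).exists_ray
  exact ⟨α, hα⟩

theorem IsCenter.dist_le (hX : GromovHyperbolic δ X) (h : IsCenter D z ξ)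
    (h' : IsCenter D' z' ξ) : dist z z' ≤ D' + 2 * D + 2 * δ := by
  obtain ⟨α, hα⟩ := ξ.exists_rays
  have key : ∀ {D : ℝ} {z : X}, IsCenter D z ξ →
      ∀ᶠ s in atTop, ∀ a b, a ≠ b → gromovProd z ((α a).1 s) ((α b).1 s) ≤ D := fun h => by
    simp only [eventually_all]
    exact fun a b hab => (h a b hab _ _ (hα a) (hα b)).eventually
  obtain ⟨s, hs, hs'⟩ := ((key h).and (key h')).exists
  exact hX.dist_centers_le (x := fun a => (α a).1 s) hs hs'

/-- Ideal triangles have centers, with a constant that depends only on the hyperbolicity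
constant. -/
theorem GromovHyperbolic.exists_isCenter (hX : GromovHyperbolic δ X) (ξ : BoundaryTriple X) :
    ∃ z, IsCenter (5 * δ) z ξ := by
  obtain ⟨α, hα⟩ := ξ.exists_rays
  have hδ := hX.nonneg
  let p := (α 0).1 0
  have hne : ∀ a b, a ≠ b → (α a).endpoint ≠ (α b).endpoint := fun a b hab h =>
    hab (ξ.2 (by rw [← hα a, ← hα b, h]))
  have hE : ∀ a b, ∃ E, a ≠ b → EventuallyProdLE E p (α a).1 (α b).1 := fun a b => by
    by_cases hab : a = b
    · exact ⟨0, fun h => absurd hab h⟩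
    · obtain ⟨E, hE⟩ := hX.exists_eventuallyProdLE (hne a b hab) p
      exact ⟨E, fun _ => hE⟩
  choose E hE using hE
  set E₀ : ℝ := ∑ a, ∑ b, |E a b| with hE₀
  have hEle : ∀ a b, E a b ≤ E₀ := fun a b => by
    refine (le_abs_self _).trans ?_
    refine (Finset.single_le_sum (f := fun b => |E a b|) (fun _ _ => abs_nonneg _)
      (Finset.mem_univ b)).trans ?_
    exact Finset.single_le_sum (f := fun a => ∑ b, |E a b|)
      (fun _ _ => Finset.sum_nonneg fun _ _ => abs_nonneg _) (Finset.mem_univ a)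
  have h1 : ∀ᶠ s in atTop, ∀ a b, a ≠ b → gromovProd p ((α a).1 s) ((α b).1 s) ≤ E₀ := by
    simp only [eventually_all]
    exact fun a b hab => ((hE a b hab).mono (hEle a b)).eventually
  -- The last bracket bounds the distance from `p` to a center of the finite triangle with vertices
  -- `(α a).1 s`: as `p` is an `E₀`-center, this bound is independent of `s`. Hence for large `s`
  -- the rays beyond time `s` look constant from the center.
  have h2 : ∀ᶠ s : ℝ≥0 in atTop, ∀ a, 3 * δ + dist ((α a).1 0) p + (δ + 2 * E₀ + 2 * δ) < s := by
    simp only [eventually_all]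
    exact fun a => NNReal.tendsto_coe_atTop.2 tendsto_id |>.eventually_gt_atTop _
  obtain ⟨s, hs1, hs2⟩ := (h1.and h2).exists
  obtain ⟨z, hz⟩ := hX.exists_center fun a => (α a).1 s
  have hpz := hX.dist_centers_le hs1 hz
  refine ⟨z, ?_⟩
  have hbig : ∀ a s', s ≤ s' → 3 * δ < gromovProd z ((α a).1 s) ((α a).1 s') := by
    intro a s' hs'
    have h3 := gromovProd_le_base ((α a).1 0) z ((α a).1 s) ((α a).1 s')
    have h4 : gromovProd ((α a).1 0) ((α a).1 s) ((α a).1 s') = s := by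
      have := (α a).between hs'
      rw [(α a).dist_zero] at this
      unfold gromovProd
      rw [(α a).dist_zero]
      linarith
    have h5 := hs2 a
    have h6 := dist_triangle ((α a).1 0) p z
    linarith
  have : IsCenter (3 * δ + 2 * δ) z ξ := isCenter_of_rays hX hα fun a b hab => by
    refine ⟨s, fun s' hs' t' ht' => ?_⟩
    have h3 := hz a b hab
    have h4 : gromovProd z ((α a).1 s) ((α b).1 t') ≤ δ + δ :=
      hX.gromovProd_le_of_lt h3 (by rw [gromovProd_comm]; linarith [hbig b t' ht'])
    rw [gromovProd_comm] at h4 ⊢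
    have h5 : gromovProd z ((α b).1 t') ((α a).1 s') ≤ δ + δ + δ :=
      hX.gromovProd_le_of_lt h4 (by rw [gromovProd_comm]; linarith [hbig a s' hs'])
    linarith
  intro a b hab α' β' h h'
  exact (this a b hab α' β' h h').mono (by linarith)

/-- The rays from a center to the vertices of an ideal triangle. -/
theorem IsCenter.exists_tripod [ProperSpace X] (hX : GromovHyperbolic δ X) (h : IsCenter D z ξ) :
    ∃ r : Fin 3 → GeodesicRay X, (∀ a, (r a).1 0 = z) ∧ (∀ a, (r a).endpoint = ξ.1 a) ∧
      ∀ a b, a ≠ b → ∀ s t, gromovProd z ((r a).1 s) ((r b).1 t) ≤ D := by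
  obtain ⟨α, hα⟩ := ξ.exists_rays
  obtain ⟨M, -, hM⟩ := exists_ray_isNear.{u} hX.nonneg zero_le_one
  have : ∀ a, ∃ r : GeodesicRay X, r.1 0 = z ∧ r.endpoint = ξ.1 a := fun a => by
    obtain ⟨r, hr0, hr⟩ := hM X hX Set.univ hX.hasCompactGeodesics_univ
      (fun x => ⟨x, trivial, by simp⟩) (α a).1 (α a).quasiEmbedding z
    refine ⟨r, hr0, ?_⟩
    rw [← hα a]
    exact (GeodesicRay.endpoint_eq_iff.2 ⟨_, hr⟩).symm
  choose r hr0 hr using this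
  refine ⟨r, hr0, hr, fun a b hab s t => ?_⟩
  obtain ⟨S, hS⟩ := h a b hab (r a) (r b) (hr a) (hr b)
  have h1 := hS (max s S) (le_max_right _ _) (max t S) (le_max_right _ _)
  have h2 := (r a).between (le_max_left s S)
  have h3 := (r b).between (le_max_left t S)
  rw [hr0] at h2 h3
  refine (gromovProd_le_of_between _ h2).trans (le_trans ?_ h1)
  rw [gromovProd_comm, gromovProd_comm z ((r a).1 _)]
  exact gromovProd_le_of_between _ h3

end Centers

/-! ### Barycenters and centers -/

section Lines

variable {X : Type u} [MetricSpace X] {δ D : ℝ} {z : X} {ξ : BoundaryTriple X}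

theorem Isometry.comp_coe_nnreal {β : ℝ → X} (h : Isometry β) :
    Isometry fun t : ℝ≥0 => β t :=
  h.comp NNReal.isometry_coe

theorem Isometry.comp_neg_coe_nnreal {β : ℝ → X} (h : Isometry β) :
    Isometry fun t : ℝ≥0 => β (-(t : ℝ)) :=
  h.comp ((IsometryEquiv.neg ℝ).isometry.comp NNReal.isometry_coe)

theorem Isometry.between_real {β : ℝ → X} (h : Isometry β) {r s t : ℝ} (hrs : r ≤ s)
    (hst : s ≤ t) : dist (β r) (β s) + dist (β s) (β t) = dist (β r) (β t) := by
  simp only [h.dist_eq, Real.dist_eq]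
  rw [abs_of_nonpos (by linarith), abs_of_nonpos (by linarith), abs_of_nonpos (by linarith)]
  ring

/-- The product at `z` of far points on the two ends of a line is bounded, which bounds the distance
from `z` to the point of the line at the internal point of the triangle. -/
theorem IsCenter.isBarycenter (hX : GromovHyperbolic δ X) (h : IsCenter D z ξ) :
    IsBarycenter (D + 4 * δ) z ξ := by
  intro a b hab β hβ
  obtain ⟨α₁, h₁⟩ := (ξ.1 a).exists_ray
  obtain ⟨α₂, h₂⟩ := (ξ.1 b).exists_ray
  have hn := hβ.neg_end
  have hp := hβ.pos_end
  rw [← h₁] at hn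
  rw [← h₂] at hp
  obtain ⟨T, hT⟩ := (h a b hab α₁ α₂ h₁ h₂).of_isNear hX α₁.quasiEmbedding
    hβ.isometry.comp_neg_coe_nnreal.quasiEmbedding hn.isNear α₂.quasiEmbedding
    hβ.isometry.comp_coe_nnreal.quasiEmbedding hp.isNear
  have h3 := hT T le_rfl T le_rfl
  set g := gromovProd (β (-(T : ℝ))) z (β T) with hg
  have hg0 : 0 ≤ g := gromovProd_nonneg _ _ _
  have hgT : g ≤ 2 * T := by
    have := gromovProd_le_dist_right (β (-(T : ℝ))) z (β T)
    rw [hβ.isometry.dist_eq, Real.dist_eq, abs_of_nonpos (by linarith [T.coe_nonneg])] at this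
    linarith
  have h4 := hX.dist_le_of_between z (hβ.isometry.between_real
    (show -(T : ℝ) ≤ -T + g by linarith) (show -T + g ≤ (T : ℝ) by linarith)) (by
      rw [hβ.isometry.dist_eq, Real.dist_eq, ← hg, abs_of_nonpos (by linarith)]
      ring)
  exact ⟨-T + g, by linarith⟩

/-- Bounded products force the geodesics from `α.1 n` to `β.1 n` to pass within `R` of `p`; a limit
of them is the line. -/
theorem GromovHyperbolic.exists_isGeodesicLine [ProperSpace X] (hX : GromovHyperbolic δ X)
    {α β : GeodesicRay X} (h : α.endpoint ≠ β.endpoint) :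
    ∃ ℓ : ℝ → X, IsGeodesicLine ℓ α.endpoint β.endpoint := by
  let p := α.1 0
  obtain ⟨E, hE⟩ := hX.exists_eventuallyProdLE h p
  choose c hc using fun n : ℕ => hX.geodesic (α.1 n) (β.1 n)
  choose τ _ hτd hτ using fun n : ℕ => hX.exists_dist_le p (hc n)
  let U := hyperfilter ℕ
  have hU : (U : Filter ℕ) ≤ atTop := Nat.hyperfilter_le_atTop
  set R := E + 2 * δ with hR
  have hR' : ∀ᶠ n in (U : Filter ℕ), dist p (c n (τ n)) ≤ R := by
    filter_upwards [hU (tendsto_natCast_atTop_atTop.eventually hE.eventually)] with n hn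
    linarith [hτ n]
  have hτα : ∀ n : ℕ, dist (α.1 n) (c n (τ n)) = τ n := fun n => by
    rw [(hc n).dist_source]
    exact min_eq_left (hτd n)
  have hleft : ∀ s : ℝ, ∀ᶠ n in (U : Filter ℕ), s ≤ τ n := fun s => by
    filter_upwards [hR', hU ((α.quasiEmbedding.tendsto_dist p).comp
      tendsto_natCast_atTop_atTop |>.eventually_ge_atTop (s + R))] with n h1 h2
    have h3 := hτα n
    have h4 := dist_triangle_right p (α.1 n) (c n (τ n))
    simp only [Function.comp_apply] at h2
    linarith
  have hright : ∀ s : ℝ, ∀ᶠ n in (U : Filter ℕ), s + τ n ≤ dist (α.1 n) (β.1 n) := fun s => by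
    filter_upwards [hR', hU ((β.quasiEmbedding.tendsto_dist p).comp
      tendsto_natCast_atTop_atTop |>.eventually_ge_atTop (s + R))] with n h1 h2
    have h3 := hτα n
    have h4 := dist_triangle p (c n (τ n)) (β.1 n)
    have h5 := (hc n).between (τ n)
    simp only [Function.comp_apply] at h2
    linarith
  -- The segments are recentred so that time `0` is the point near `p`; `Real.toNNReal` makes them
  -- constant before their start.
  let L : ℕ → ℝ → X := fun n s => c n (Real.toNNReal (s + τ n))
  have hLip : ∀ n s t, dist (L n s) (L n t) ≤ dist s t := fun n s t => by
    refine ((hc n).dist_le _ _).trans ?_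
    rw [NNReal.dist_eq, Real.coe_toNNReal', Real.coe_toNNReal', Real.dist_eq]
    refine (abs_max_sub_max_le_abs _ _ _).trans ?_
    simp
  have hL0 : ∀ n, L n 0 = c n (τ n) := fun n => by simp [L]
  have hdist : ∀ s : ℝ, ∀ᶠ n : ℕ in (U : Filter ℕ), dist (α.1 n) (L n s) = s + τ n := fun s => by
    filter_upwards [hleft (-s), hright s] with n h1 h2
    rw [(hc n).dist_source, Real.coe_toNNReal _ (by linarith), min_eq_left h2]
  obtain ⟨ℓ, hℓ, hlim⟩ := U.exists_isometry_tendsto (c := L)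
    (fun s => ⟨_, isCompact_closedBall p (R + |s|), by
      filter_upwards [hR'] with n hn
      rw [Metric.mem_closedBall, dist_comm]
      have h1 := hLip n 0 s
      rw [hL0, Real.dist_eq, zero_sub, abs_neg] at h1
      linarith [dist_triangle p (c n (τ n)) (L n s)]⟩)
    (fun s t => by
      filter_upwards [hleft (-s), hright s, hleft (-t), hright t] with n h1 h2 h3 h4
      have h5 : (s + τ n).toNNReal ≤ nndist (α.1 n) (β.1 n) := Real.toNNReal_le_iff_le_coe.2 h2
      have h6 : (t + τ n).toNNReal ≤ nndist (α.1 n) (β.1 n) := Real.toNNReal_le_iff_le_coe.2 h4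
      rw [(hc n).isometric _ _ h5 h6, NNReal.dist_eq, Real.coe_toNNReal _ (by linarith),
        Real.coe_toNNReal _ (by linarith), Real.dist_eq]
      ring_nf)
  refine ⟨ℓ, hℓ, hℓ.comp_neg_coe_nnreal.quasiEmbedding.endsAt_endpoint
    ⟨1 + (R + dist p (α.1 0) + 2 * δ), fun t => ?_⟩,
    hℓ.comp_coe_nnreal.quasiEmbedding.endsAt_endpoint
    ⟨1 + (R + dist p (β.1 0) + 2 * δ), fun t => ?_⟩⟩
  · obtain ⟨n, h1, h2, h3⟩ := (((Metric.tendsto_nhds.1 (hlim (-(t : ℝ)))) 1 one_pos).and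
      ((hdist (-(t : ℝ))).and hR')).exists
    have hb : dist (c n (τ n)) (L n (-(t : ℝ))) + dist (L n (-(t : ℝ))) (α.1 n) =
        dist (c n (τ n)) (α.1 n) := by
      have h4 := hLip n 0 (-(t : ℝ))
      rw [hL0, Real.dist_eq, zero_sub, neg_neg, abs_of_nonneg t.coe_nonneg] at h4
      have h5 := hτα n
      have h6 := dist_triangle (c n (τ n)) (L n (-(t : ℝ))) (α.1 n)
      rw [dist_comm _ (α.1 n)] at *
      rw [dist_comm _ (α.1 n)] at *
      linarith
    have h7 := gromovProd_eq_zero_of_between hb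
    have h8 := gromovProd_le_left (L n (-(t : ℝ))) (α.1 0) (c n (τ n)) (α.1 n)
    have h9 := dist_triangle_left (α.1 0) (c n (τ n)) p
    obtain ⟨r, -, -, hr⟩ := hX.exists_dist_ray_le (w := L n (-(t : ℝ))) (β := α) (t := n)
      (E := R + dist p (α.1 0)) (by linarith)
    refine ⟨r, ?_⟩
    rw [dist_comm] at h1
    linarith [dist_triangle (ℓ (-(t : ℝ))) (L n (-(t : ℝ))) (α.1 r)]
  · obtain ⟨n, h1, h2, h3⟩ := (((Metric.tendsto_nhds.1 (hlim t)) 1 one_pos).and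
      ((hdist t).and hR')).exists
    have hb : dist (c n (τ n)) (L n t) + dist (L n t) (β.1 n) = dist (c n (τ n)) (β.1 n) := by
      have h4 := hLip n 0 t
      rw [hL0, Real.dist_eq, zero_sub, abs_neg, abs_of_nonneg t.coe_nonneg] at h4
      have h5 := hτα n
      have h6 := dist_triangle (c n (τ n)) (L n t) (β.1 n)
      have h7 := (hc n).between (τ n)
      have h8 := (hc n).between (t + τ n : ℝ).toNNReal
      change dist (α.1 n) (L n t) + dist (L n t) (β.1 n) = _ at h8
      linarith
    have h7 := gromovProd_eq_zero_of_between hb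
    have h8 := gromovProd_le_left (L n t) (β.1 0) (c n (τ n)) (β.1 n)
    have h9 := dist_triangle_left (β.1 0) (c n (τ n)) p
    obtain ⟨r, -, -, hr⟩ := hX.exists_dist_ray_le (w := L n t) (β := β) (t := n)
      (E := R + dist p (β.1 0)) (by linarith)
    refine ⟨r, ?_⟩
    rw [dist_comm] at h1
    linarith [dist_triangle (ℓ t) (L n t) (β.1 r)]

/-- Being a barycenter says something only if the vertices are joined by lines, whence the
properness. -/
theorem IsBarycenter.isCenter [ProperSpace X] (hX : GromovHyperbolic δ X)
    (h : IsBarycenter D z ξ) : IsCenter (D + 2 * δ) z ξ := by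
  intro a b hab α β hα hβ
  have hne : α.endpoint ≠ β.endpoint := fun he => hab (ξ.2 (by rw [← hα, ← hβ, he]))
  obtain ⟨ℓ, hℓ⟩ := hX.exists_isGeodesicLine hne
  obtain ⟨t₀, ht₀⟩ := h a b hab ℓ (by rwa [← hα, ← hβ])
  have h1 : EventuallyProdLE D z (fun t : ℝ≥0 => ℓ (-(t : ℝ))) (fun t : ℝ≥0 => ℓ t) := by
    refine ⟨Real.nnabs t₀, fun s hs t ht => ?_⟩
    have hs' : |t₀| ≤ s := by simpa using NNReal.coe_le_coe.2 hs
    have ht' : |t₀| ≤ t := by simpa using NNReal.coe_le_coe.2 ht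
    exact (gromovProd_le_dist_of_between (hℓ.isometry.between_real
      (by linarith [neg_abs_le t₀]) ((le_abs_self t₀).trans ht'))).trans ht₀
  exact h1.of_isNear hX hℓ.isometry.comp_neg_coe_nnreal.quasiEmbedding α.quasiEmbedding
    hℓ.neg_end.isNear_symm hℓ.isometry.comp_coe_nnreal.quasiEmbedding β.quasiEmbedding
    hℓ.pos_end.isNear_symm

end Lines

/-! ### Quasi-isometric embeddings and centers -/

/-- When the product at `z` is bounded, going from `x` to `z` and on to `y` along geodesics is a
quasigeodesic. Its image is one too, and the Morse lemma bounds the product at the intermediate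
point `φ z`. -/
theorem exists_gromovProd_map_le {δ A D : ℝ} (hδ : 0 ≤ δ) (hA : 0 ≤ A) (hD : 0 ≤ D) :
    ∃ M : ℝ, 0 ≤ M ∧ ∀ (X Y : Type u) [MetricSpace X] [MetricSpace Y], GromovHyperbolic δ X →
      GromovHyperbolic δ Y → ∀ φ : X → Y, QuasiEmbedding A φ → ∀ z x y,
        gromovProd z x y ≤ D → gromovProd (φ z) (φ x) (φ y) ≤ M := by
  obtain ⟨M, hM0, hM⟩ := exists_gromovProd_quasiGeodesicSeq_le.{u} hδ
    (show 0 ≤ A + A + (2 * D + 2) by positivity)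
  refine ⟨M, hM0, fun X Y _ _ hX hY φ hφ z x y hz => ?_⟩
  obtain ⟨c, hc⟩ := hX.geodesic z x
  obtain ⟨c', hc'⟩ := hX.geodesic z y
  set N := ⌈nndist z x⌉₊ with hN
  set N' := ⌈nndist z y⌉₊ with hN'
  let g : ℕ → X := fun i => if i ≤ N then c ((N - i : ℕ) : ℝ≥0) else c' ((i - N : ℕ) : ℝ≥0)
  have hcast : ∀ i j : ℕ, dist (i : ℝ≥0) (j : ℝ≥0) = |(i : ℝ) - j| := fun i j => by
    rw [NNReal.dist_eq]; simp
  have hg0 : g 0 = x := by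
    simp only [g, Nat.zero_le, if_true, Nat.sub_zero]
    exact hc.target _ (Nat.le_ceil _)
  have hgN : g N = z := by
    simp only [g, le_refl, if_true, Nat.sub_self, Nat.cast_zero]
    exact hc.source
  have hgn : g (N + N') = y := by
    rcases Nat.eq_zero_or_pos N' with h | h
    · rw [h, add_zero, hgN]
      have : nndist z y ≤ 0 := by
        have := Nat.le_ceil (nndist z y)
        rw [← hN', h] at this
        simpa using this
      exact nndist_eq_zero.1 (nonpos_iff_eq_zero.1 this)
    · simp only [g]
      rw [if_neg (by omega), Nat.add_sub_cancel_left]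
      exact hc'.target _ (Nat.le_ceil _)
  have hstep : ∀ i, dist (g i) (g (i + 1)) ≤ 1 := by
    intro i
    simp only [g]
    split_ifs with h1 h2 h2
    · refine (hc.dist_le _ _).trans ?_
      rw [hcast, Nat.cast_sub h1, Nat.cast_sub h2]
      push_cast
      simp
    · obtain rfl : i = N := by omega
      rw [Nat.sub_self, Nat.cast_zero, hc.source, ← hc'.source, Nat.add_sub_cancel_left]
      refine (hc'.dist_le _ _).trans ?_
      rw [← Nat.cast_zero, hcast]
      simp
    · omega
    · refine (hc'.dist_le _ _).trans ?_
      rw [hcast, Nat.cast_sub (by omega), Nat.cast_sub (by omega)]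
      push_cast
      simp
  have hlow : ∀ (v : X) (d : ℝ≥0 → X), IsGeodesicSegment d z v → ∀ i : ℕ, i ≤ ⌈nndist z v⌉₊ →
      (i : ℝ) - 1 ≤ dist z (d i) := by
    intro v d hd i hi
    rw [hd.dist_source]
    have h1 : ((⌈nndist z v⌉₊ : ℕ) : ℝ≥0) < nndist z v + 1 := Nat.ceil_lt_add_one zero_le
    have h2 : (⌈nndist z v⌉₊ : ℝ) < dist z v + 1 := by exact_mod_cast NNReal.coe_lt_coe.2 h1
    have h3 : (i : ℝ) ≤ ⌈nndist z v⌉₊ := by exact_mod_cast hi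
    refine le_min ?_ (by linarith)
    simp
  have hlow2 : ∀ (v : X) (d : ℝ≥0 → X), IsGeodesicSegment d z v → ∀ i j : ℕ, j ≤ i →
      i ≤ ⌈nndist z v⌉₊ → (i : ℝ) - j - 1 ≤ dist (d i) (d j) := by
    intro v d hd i j hji hi
    have h1 := hlow v d hd i hi
    have h2 := hd.dist_source j
    have h3 := min_le_left ((j : ℝ≥0) : ℝ) (dist z v)
    have h4 := dist_triangle_right z (d i) (d j)
    simp only [NNReal.coe_natCast] at h2 h3
    linarith
  -- Across `z`, products only decrease when points move towards `z`, which costs `2 * D`; rounding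
  -- the lengths up to `N` and `N'` costs `1` on each side.
  have hsub : ∀ i j, i ≤ j → j ≤ N + N' → (j : ℝ) - i ≤ dist (g i) (g j) + (2 * D + 2) := by
    intro i j hij hj
    simp only [g]
    split_ifs with h1 h2 h2
    · have := hlow2 x c hc (N - i) (N - j) (by omega) (Nat.sub_le _ _)
      rw [Nat.cast_sub h1, Nat.cast_sub h2] at this
      linarith
    · have e1 := hlow x c hc (N - i) (Nat.sub_le _ _)
      have e2 := hlow y c' hc' (j - N) (by omega)
      have e3 := (gromovProd_le_of_between y (hc.between ((N - i : ℕ) : ℝ≥0))).trans hz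
      have e4 := gromovProd_le_of_between (c ((N - i : ℕ) : ℝ≥0))
        (hc'.between ((j - N : ℕ) : ℝ≥0))
      rw [gromovProd_comm z y] at e4
      have e5 := e4.trans e3
      unfold gromovProd at e5
      rw [dist_comm (c' _)] at e5
      rw [Nat.cast_sub (by omega)] at e1 e2
      linarith
    · omega
    · have := hlow2 y c' hc' (j - N) (i - N) (by omega) (by omega)
      rw [dist_comm]
      rw [Nat.cast_sub (by omega), Nat.cast_sub (by omega)] at this
      linarith
  have hφg : IsQuasiGeodesicSeq (A + A + (2 * D + 2)) (fun i => φ (g i)) (N + N') := by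
    constructor
    · intro i _
      have h1 := (hφ (g i) (g (i + 1))).1
      have h2 : A * dist (g i) (g (i + 1)) ≤ A * 1 := by
        gcongr
        exact hstep i
      linarith
    · intro i j hij hj
      have h1 := (hφ (g i) (g j)).2
      have h2 := hsub i j hij hj
      have h3 : 0 ≤ (A + (2 * D + 2)) * dist (φ (g i)) (φ (g j)) := by positivity
      linarith
  have := (hM Y hY _ _ hφg).1 N (Nat.le_add_right _ _)
  simpa only [hg0, hgN, hgn] using this

theorem exists_isCenter_map {δ A D : ℝ} (hδ : 0 ≤ δ) (hA : 0 ≤ A) (hD : 0 ≤ D) :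
    ∃ M : ℝ, 0 ≤ M ∧ ∀ (X Y : Type u) [MetricSpace X] [MetricSpace Y], GromovHyperbolic δ X →
      GromovHyperbolic δ Y → ∀ φ : X → Y, QuasiEmbedding A φ →
        ∀ z (ξ : BoundaryTriple X) (ξ' : BoundaryTriple Y), IsCenter D z ξ →
          (∀ a, BoundaryMapsTo φ (ξ.1 a) (ξ'.1 a)) → IsCenter M (φ z) ξ' := by
  obtain ⟨M, hM0, hM⟩ := exists_gromovProd_map_le.{u} hδ hA hD
  refine ⟨M + 2 * δ, by positivity, fun X Y _ _ hX hY φ hφ z ξ ξ' hz hξ => ?_⟩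
  intro a b hab α' β' hα' hβ'
  obtain ⟨α, hα, hαφ⟩ := hξ a
  obtain ⟨β, hβ, hβφ⟩ := hξ b
  rw [← hα'] at hαφ
  rw [← hβ'] at hβφ
  obtain ⟨S, hS⟩ := hz a b hab α β hα hβ
  have h1 : EventuallyProdLE M (φ z) (φ ∘ α.1) (φ ∘ β.1) :=
    ⟨S, fun s hs t ht => hM X Y hX hY φ hφ _ _ _ (hS s hs t ht)⟩
  have hA1 : ∀ γ : GeodesicRay Y, QuasiEmbedding (max A 1) γ.1 := fun γ =>
    γ.quasiEmbedding.mono (le_max_right _ _)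
  have hA2 : ∀ γ : GeodesicRay X, QuasiEmbedding (max A 1) (φ ∘ γ.1) := fun γ =>
    (hφ.comp_isometry γ.2).mono (le_max_left _ _)
  exact (h1.of_isNear hY (hA2 α) (hA1 α') hαφ.isNear_symm (hA2 β) (hA1 β')
    hβφ.isNear_symm).mono (by linarith)

/-! ### Metric graphs -/

namespace GraphStructure

variable {X : Type u} [MetricSpace X] {G : GraphStructure.{u, v} X}

theorem IsMetricGraph.dist_param_le (hG : G.IsMetricGraph) (e : G.Edge) {s t : ℝ}
    (hs : s ∈ Set.Icc (0 : ℝ) 1) (ht : t ∈ Set.Icc (0 : ℝ) 1) :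
    dist (G.param e s) (G.param e t) ≤ |s - t| := by
  have h := (hG (G.param e s) (G.param e t)).1 (PLPath.cons e s t hs ht (fun _ _ => Set.mem_univ _) _ _
    (.nil _ trivial))
  simpa using h

theorem param_mem_vert_iff {Y : Type u} {G : GraphStructure.{u, v} Y} (e : G.Edge) {s : ℝ} (hs : s ∈ Set.Icc (0 : ℝ) 1) :
    G.param e s ∈ G.vert ↔ s = 0 ∨ s = 1 := by
  constructor
  · intro h
    by_contra! hne
    exact G.interior_notMem e s ⟨lt_of_le_of_ne hs.1 hne.1.symm, lt_of_le_of_ne hs.2 hne.2⟩ h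
  · rintro (rfl | rfl)
    · exact G.param_zero_mem e
    · exact G.param_one_mem e

theorem IsMetricGraph.dist_le_one_of_adj (hG : G.IsMetricGraph) {x y : X} (h : G.Adj x y) :
    dist x y ≤ 1 := by
  obtain ⟨e, ⟨rfl, rfl⟩ | ⟨rfl, rfl⟩⟩ := h
  · simpa using hG.dist_param_le e (show (0 : ℝ) ∈ Set.Icc (0 : ℝ) 1 by simp)
      (show (1 : ℝ) ∈ Set.Icc (0 : ℝ) 1 by simp)
  · simpa using hG.dist_param_le e (show (1 : ℝ) ∈ Set.Icc (0 : ℝ) 1 by simp)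
      (show (0 : ℝ) ∈ Set.Icc (0 : ℝ) 1 by simp)

theorem IsMetricGraph.exists_vert_dist_le (hG : G.IsMetricGraph) (x : X) :
    ∃ v ∈ G.vert, dist x v ≤ 1 := by
  rcases G.cover x with hx | ⟨e, t, ht, rfl⟩
  · exact ⟨x, hx, by simp⟩
  · refine ⟨_, G.param_zero_mem e, ?_⟩
    have := hG.dist_param_le e (Set.Ioo_subset_Icc_self ht)
      (show (0 : ℝ) ∈ Set.Icc (0 : ℝ) 1 by simp)
    rw [sub_zero, abs_of_pos ht.1] at this
    exact this.trans ht.2.le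

/-- The second clause strengthens the first for the induction: a path shorter than `1` cannot leave
the open star of the vertex `y`. `transfer` passes from one description of a point as an edge
parameter to all others. -/
theorem PLPath.length_to_vert {Y : Type u} {G : GraphStructure.{u, v} Y} {S : Set Y} {x y : Y}
    {ℓ : ℝ} (h : G.PLPath S x y ℓ)
    (hy : y ∈ G.vert) :
    (x ∈ G.vert → x = y ∨ 1 ≤ ℓ) ∧ ∀ e, ∀ s ∈ Set.Icc (0 : ℝ) 1, G.param e s = x →
      (G.param e 0 = y ∧ s ≤ ℓ) ∨ (G.param e 1 = y ∧ 1 - s ≤ ℓ) ∨ 1 ≤ ℓ := by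
  have transfer : ∀ {x ℓ}, 0 ≤ ℓ → ∀ e, ∀ s ∈ Set.Icc (0 : ℝ) 1, G.param e s = x →
      ((G.param e 0 = y ∧ s ≤ ℓ) ∨ (G.param e 1 = y ∧ 1 - s ≤ ℓ) ∨ 1 ≤ ℓ) →
      (x ∈ G.vert → x = y ∨ 1 ≤ ℓ) ∧ ∀ e, ∀ s ∈ Set.Icc (0 : ℝ) 1, G.param e s = x →
      (G.param e 0 = y ∧ s ≤ ℓ) ∨ (G.param e 1 = y ∧ 1 - s ≤ ℓ) ∨ 1 ≤ ℓ := by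
    rintro x ℓ h0 e s hs rfl h
    have hv : G.param e s ∈ G.vert → G.param e s = y ∨ 1 ≤ ℓ := by
      intro hmem
      rcases (param_mem_vert_iff e hs).1 hmem with rfl | rfl
      · rcases h with h | h | h
        · exact .inl h.1
        · exact .inr (by linarith)
        · exact .inr h
      · rcases h with h | h | h
        · exact .inr h.2
        · exact .inl h.1
        · exact .inr h
    refine ⟨hv, fun e' s' hs' heq => ?_⟩
    by_cases hmem : G.param e s ∈ G.vert
    · rcases hv hmem with hv | hv
      · rw [← heq] at hmem hv
        rcases (param_mem_vert_iff e' hs').1 hmem with rfl | rfl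
        · exact .inl ⟨hv, h0⟩
        · exact .inr (.inl ⟨hv, by simpa using h0⟩)
      · exact .inr (.inr hv)
    · have hmem' : G.param e' s' ∉ G.vert := heq ▸ hmem
      rw [param_mem_vert_iff e hs, not_or] at hmem
      rw [param_mem_vert_iff e' hs', not_or] at hmem'
      obtain ⟨rfl, rfl⟩ := G.interior_inj e' e s'
        ⟨lt_of_le_of_ne hs'.1 (Ne.symm hmem'.1), lt_of_le_of_ne hs'.2 hmem'.2⟩ s
        ⟨lt_of_le_of_ne hs.1 (Ne.symm hmem.1), lt_of_le_of_ne hs.2 hmem.2⟩ heq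
      exact h
  induction h with
  | nil x hx =>
    refine ⟨fun _ => .inl rfl, fun e s hs heq => ?_⟩
    rw [← heq] at hy
    rcases (param_mem_vert_iff e hs).1 hy with rfl | rfl
    · exact .inl ⟨heq, le_rfl⟩
    · exact .inr (.inl ⟨heq, by simp⟩)
  | cons e s t hs ht hS y ℓ h ih =>
    have hℓ := h.nonneg
    refine transfer (add_nonneg (abs_nonneg _) hℓ) e s hs rfl ?_
    have h1 := le_abs_self (s - t)
    have h2 := neg_le_abs (s - t)
    rcases (ih hy (fun {x ℓ} => transfer)).2 e t ht rfl with h | h | h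
    · exact .inl ⟨h.1, by linarith [h.2]⟩
    · exact .inr (.inl ⟨h.1, by linarith [h.2]⟩)
    · exact .inr (.inr (by linarith [abs_nonneg (s - t)]))

theorem IsMetricGraph.one_le_dist (hG : G.IsMetricGraph) {x y : X} (hx : x ∈ G.vert)
    (hy : y ∈ G.vert) (hxy : x ≠ y) : 1 ≤ dist x y :=
  (le_isGLB_iff (hG x y)).2 fun _ hℓ => ((hℓ.length_to_vert hy).1 hx).resolve_left hxy

/-- Parallel edges can be folded together by a `1`-Lipschitz retraction that fixes the vertices
and any given point. -/
theorem IsMetricGraph.exists_retraction (hG : G.IsMetricGraph) (p : X)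
    (hfin : ∀ R : ℝ, {v | v ∈ G.vert ∧ dist p v ≤ R}.Finite) :
    ∃ ρ : X → X, LipschitzWith 1 ρ ∧ ρ p = p ∧ (∀ v ∈ G.vert, ρ v = v) ∧
      ∀ R : ℝ, ∃ C, IsCompact C ∧ ∀ x, dist p (ρ x) ≤ R → ρ x ∈ C := by
  classical
  let κ : G.Edge → X × X := fun e => (G.param e 0, G.param e 1)
  -- One edge is kept for each ordered pair of ends, and it is the edge of `p` when `p` is an
  -- interior point, so that `p` is fixed.
  have hsec : ∀ q : Set.range κ, ∃ e', κ e' = q ∧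
      ∀ e, κ e = q → ∀ t ∈ Set.Ioo (0 : ℝ) 1, G.param e t = p → e' = e := by
    rintro ⟨_, e, rfl⟩
    by_cases h : ∃ e', κ e' = κ e ∧ ∃ t ∈ Set.Ioo (0 : ℝ) 1, G.param e' t = p
    · obtain ⟨e', he', t, ht, htp⟩ := h
      exact ⟨e', he', fun e'' _ t' ht' htp' =>
        (G.interior_inj e' e'' t ht t' ht' (htp.trans htp'.symm)).1⟩
    · push Not at h
      exact ⟨e, rfl, fun e' he' t ht htp => absurd htp (h e' he' t ht)⟩
  choose sec hκ hp using hsec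
  let can : G.Edge → G.Edge := fun e => sec ⟨κ e, e, rfl⟩
  have hcan : ∀ e, κ (can e) = κ e := fun e => hκ _
  have hcan0 : ∀ e, G.param (can e) 0 = G.param e 0 := fun e => congrArg Prod.fst (hcan e)
  have hcan1 : ∀ e, G.param (can e) 1 = G.param e 1 := fun e => congrArg Prod.snd (hcan e)
  have hρ : ∀ x, ∃ y, (x ∈ G.vert → y = x) ∧
      ∀ e, ∀ t ∈ Set.Icc (0 : ℝ) 1, G.param e t = x → y = G.param (can e) t := by
    intro x
    by_cases hx : x ∈ G.vert
    · refine ⟨x, fun _ => rfl, fun e t ht hxe => ?_⟩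
      rw [← hxe] at hx
      rcases (param_mem_vert_iff e ht).1 hx with rfl | rfl
      · rw [hcan0, hxe]
      · rw [hcan1, hxe]
    · obtain ⟨e, t, ht, rfl⟩ := (G.cover x).resolve_left hx
      refine ⟨G.param (can e) t, fun h => absurd h hx, fun e' t' ht' heq => ?_⟩
      have h1 : G.param e' t' ∉ G.vert := heq ▸ hx
      rw [param_mem_vert_iff e' ht', not_or] at h1
      obtain ⟨rfl, rfl⟩ := G.interior_inj e' e t'
        ⟨lt_of_le_of_ne ht'.1 (Ne.symm h1.1), lt_of_le_of_ne ht'.2 h1.2⟩ t ht heq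
      rfl
  choose ρ hρv hρe using hρ
  have hpath : ∀ {x y ℓ}, G.PLPath Set.univ x y ℓ → G.PLPath Set.univ (ρ x) (ρ y) ℓ := by
    intro x y ℓ h
    induction h with
    | nil x _ => exact .nil _ trivial
    | cons e s t hs ht _ y ℓ _ ih =>
      rw [hρe _ e s hs rfl]
      rw [hρe _ e t ht rfl] at ih
      exact .cons (can e) s t hs ht (fun _ _ => Set.mem_univ _) _ _ ih
  refine ⟨ρ, LipschitzWith.of_dist_le_mul fun x y => ?_, ?_, fun v hv => hρv v hv, fun R => ?_⟩
  · rw [NNReal.coe_one, one_mul]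
    exact (le_isGLB_iff (hG x y)).2 fun ℓ hℓ => (hG (ρ x) (ρ y)).1 (hpath hℓ)
  · rcases G.cover p with h | ⟨e, t, ht, h⟩
    · exact hρv p h
    · rw [hρe p e t (Set.Ioo_subset_Icc_self ht) h]
      have : can e = e := hp ⟨κ e, e, rfl⟩ e rfl t ht h
      rw [this, h]
  -- The ends of an edge through a point within `R` of `p` are within `R + 1`; only finitely many
  -- kept edges have such ends.
  · set V := {v | v ∈ G.vert ∧ dist p v ≤ R + 1} with hV
    set T := {e | e ∈ Set.range can ∧ κ e ∈ V ×ˢ V} with hT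
    have hTfin : T.Finite := by
      refine Set.Finite.of_finite_image (f := κ) (((hfin (R + 1)).prod (hfin (R + 1))).subset ?_) ?_
      · rintro _ ⟨e, he, rfl⟩
        exact he.2
      · rintro _ ⟨⟨e, rfl⟩, -⟩ _ ⟨⟨e', rfl⟩, -⟩ h
        rw [hcan, hcan] at h
        simp only [can]
        congr 1
        exact Subtype.ext h
    refine ⟨V ∪ ⋃ e ∈ T, G.param e '' Set.Icc 0 1,
      (hfin (R + 1)).isCompact.union (hTfin.isCompact_biUnion fun e _ =>
        isCompact_Icc.image_of_continuousOn ?_), fun x hx => ?_⟩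
    · refine (LipschitzOnWith.of_dist_le_mul (K := 1) fun s hs t ht => ?_).continuousOn
      rw [NNReal.coe_one, one_mul]
      exact hG.dist_param_le e hs ht
    · rcases G.cover x with hv | ⟨e, t, ht, rfl⟩
      · rw [hρv x hv] at hx ⊢
        exact .inl ⟨hv, by linarith⟩
      · have ht' := Set.Ioo_subset_Icc_self ht
        rw [hρe _ e t ht' rfl] at hx ⊢
        have h0 := hG.dist_param_le (can e) ht' (show (0 : ℝ) ∈ Set.Icc (0 : ℝ) 1 by simp)
        have h1 := hG.dist_param_le (can e) ht' (show (1 : ℝ) ∈ Set.Icc (0 : ℝ) 1 by simp)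
        rw [sub_zero, abs_of_pos ht.1] at h0
        rw [abs_of_neg (by linarith [ht.2])] at h1
        refine .inr (Set.mem_iUnion₂.2 ⟨can e, ⟨⟨e, rfl⟩, ⟨G.param_zero_mem _, ?_⟩,
          G.param_one_mem _, ?_⟩, t, ht', rfl⟩)
        · linarith [dist_triangle p (G.param (can e) t) (G.param (can e) 0), ht.2]
        · linarith [dist_triangle p (G.param (can e) t) (G.param (can e) 1), ht.1]

end GraphStructure

theorem Set.Finite.of_one_le_dist {Y : Type*} [MetricSpace Y] [ProperSpace Y] {S : Set Y} {y : Y}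
    {R : ℝ} (hS : S ⊆ Metric.closedBall y R) (h : ∀ a ∈ S, ∀ b ∈ S, a ≠ b → 1 ≤ dist a b) :
    S.Finite := by
  obtain ⟨N, -, hN, hcov⟩ := (isCompact_closedBall y R).finite_cover_balls
    (show (0 : ℝ) < 1 / 2 by norm_num)
  refine (hN.biUnion (t := fun x => S ∩ Metric.ball x (1 / 2)) fun x _ => ?_).subset fun a ha => ?_
  · refine Set.Subsingleton.finite fun a ha b hb => ?_
    by_contra hab
    have h1 := h a ha.1 b hb.1 hab
    have h2 := Metric.mem_ball.1 ha.2
    have h3 := Metric.mem_ball.1 hb.2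
    linarith [dist_triangle_right a b x]
  · obtain ⟨x, hx, hax⟩ := Set.mem_iUnion₂.1 (hcov (hS ha))
    exact Set.mem_biUnion hx ⟨ha, hax⟩

/-- Cutting the geodesic into pieces of length at most `1` turns control at scale `1` into a coarse
Lipschitz bound. -/
theorem dist_map_le_of_geodesic {Y Z : Type*} [MetricSpace Y] [MetricSpace Z] {g : Y → Z} {B : ℝ}
    (hB : ∀ x y, dist x y ≤ 1 → dist (g x) (g y) ≤ B) {x y : Y} {c : ℝ≥0 → Y}
    (hc : IsGeodesicSegment c x y) : dist (g x) (g y) ≤ B * dist x y + B := by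
  have hB0 : 0 ≤ B := dist_nonneg.trans (hB x x (by simp))
  have h1 := dist_le_range_sum_of_dist_le (f := fun k : ℕ => g (c k)) ⌈nndist x y⌉₊
    (d := fun _ => B) fun {k} _ => hB _ _ ((hc.dist_le _ _).trans (by
      rw [NNReal.dist_eq]; push_cast; simp))
  rw [Finset.sum_const, Finset.card_range, nsmul_eq_mul, Nat.cast_zero, hc.source,
    hc.target _ (Nat.le_ceil _)] at h1
  have h2 : ((⌈nndist x y⌉₊ : ℕ) : ℝ≥0) < nndist x y + 1 := Nat.ceil_lt_add_one zero_le
  have h3 : (⌈nndist x y⌉₊ : ℝ) < dist x y + 1 := by exact_mod_cast NNReal.coe_lt_coe.2 h2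
  have h4 : (⌈nndist x y⌉₊ : ℝ) * B ≤ (dist x y + 1) * B := by gcongr
  linarith

/-! ### Fibers of metric graph bundles -/

namespace IsMetricGraphBundle

variable {X : Type u} [MetricSpace X] {G : GraphStructure.{u, v} X} {f : ℕ → ℕ} {π : X → ℝ≥0}
  (h : IsMetricGraphBundle G f π)

theorem dist_val_le {i : ℕ} (x y : h.Fiber i) : dist x.val y.val ≤ dist x y :=
  h.isMetricGraph.dist_le_pathDist (h.fiber_connected i x.1 x.2 y.1 y.2)

theorem fiber_dist_le {i : ℕ} {x y : h.Fiber i} {r : ℕ} (hr : dist x.val y.val ≤ r) :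
    dist x y ≤ f r :=
  h.fiber_proper i x.1 x.2 y.1 y.2 r hr

include h in
theorem dist_proj_le (x y : X) : |(π x : ℝ) - π y| ≤ dist x y := by
  have := h.lipschitz.dist_le_mul x y
  rwa [NNReal.dist_eq, NNReal.coe_one, one_mul] at this

include h in
theorem exists_vert_fiber {i : ℕ} {x : X} (hx : π x = i) :
    ∃ v ∈ G.vert, π v = i ∧ dist x v ≤ 1 := by
  rcases G.cover x with hv | ⟨e, t, ht, rfl⟩
  · exact ⟨x, hv, hx, by simp⟩
  · refine ⟨_, G.param_zero_mem e, ?_, ?_⟩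
    · obtain ⟨h1, h2⟩ := h.map_edge e
      have h3 := h2 t (Set.Ioo_subset_Icc_self ht)
      obtain ⟨a, ha⟩ := h.map_vert _ (G.param_zero_mem e)
      obtain ⟨b, hb⟩ := h.map_vert _ (G.param_one_mem e)
      rw [hx, ha, hb] at h3
      rw [ha, hb] at h1
      rw [ha]
      simp only [NNReal.coe_natCast] at h1 h3
      have h4 : |(a : ℤ) - b| ≤ 1 := by exact_mod_cast h1
      rw [abs_le] at h4
      -- If `π` is not constant on the edge, it takes no integer value in the interior, so only the
      -- first case is possible.
      have h5 : a = b ∨ b = a + 1 ∨ a = b + 1 := by omega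
      rcases h5 with rfl | rfl | rfl
      · have : (i : ℝ) = a := by linarith
        exact_mod_cast this.symm
      · push_cast at h3
        have h6 : (a : ℝ) < i := by linarith [ht.1]
        have h7 : (i : ℝ) < a + 1 := by linarith [ht.2]
        have h8 : a < i := by exact_mod_cast h6
        have h9 : i < a + 1 := by exact_mod_cast h7
        omega
      · push_cast at h3
        have h6 : (b : ℝ) < i := by linarith [ht.2]
        have h7 : (i : ℝ) < b + 1 := by linarith [ht.1]
        have h8 : b < i := by exact_mod_cast h6
        have h9 : i < b + 1 := by exact_mod_cast h7
        omega
    · have := h.isMetricGraph.dist_param_le e (Set.Ioo_subset_Icc_self ht)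
        (show (0 : ℝ) ∈ Set.Icc (0 : ℝ) 1 by simp)
      rw [sub_zero, abs_of_pos ht.1] at this
      exact this.trans ht.2.le

theorem nonempty_fiber (i : ℕ) : Nonempty (h.Fiber i) := by
  obtain ⟨x, hx⟩ := h.surjective i
  exact ⟨⟨x, hx⟩⟩

theorem exists_fiber_map {i j : ℕ} (hij : j = i + 1 ∨ i = j + 1) :
    ∃ ψ : h.Fiber i → h.Fiber j, ∀ x, dist x.val (ψ x).val ≤ 2 := by
  have : ∀ x : h.Fiber i, ∃ y : h.Fiber j, dist x.val y.val ≤ 2 := fun x => by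
    obtain ⟨v, hv, hvi, hd⟩ := h.exists_vert_fiber x.mem
    obtain ⟨y, -, hy, hadj⟩ := h.exists_adj i j hij v hv hvi
    have := h.isMetricGraph.dist_le_one_of_adj hadj
    exact ⟨⟨y, hy⟩, by linarith [dist_triangle x.val v y]⟩
  choose ψ hψ using this
  exact ⟨ψ, hψ⟩

theorem IsNaturalMap.dist_le {h : IsMetricGraphBundle G f π} {i : ℕ}
    {φ : h.Fiber i → h.Fiber (i + 1)} (hφ : h.IsNaturalMap i φ) (x : h.Fiber i) :
    dist x.val (φ x).val ≤ 2 := by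
  by_cases hx : x.val ∈ G.vert
  · linarith [h.isMetricGraph.dist_le_one_of_adj (hφ.map_vert x hx).2]
  · obtain ⟨v, hv, hd, he⟩ := hφ.map_interior x hx
    rw [he]
    have h1 := h.isMetricGraph.dist_le_one_of_adj (hφ.map_vert v hv).2
    have h2 := h.dist_val_le x v
    linarith [dist_triangle x.val v.val (φ v).val]

/-- Points at distance `1` have images at distance at most `2 + 1 + 2 = 5` in `X`, hence `f 5` in
the fiber. Going to the neighbouring fiber and back moves a point by at most `2 + 2 = 4`, hence `f
4`, so the return map gives the lower bound. -/
theorem quasiEmbedding_fiber_map {i j : ℕ} (hij : j = i + 1 ∨ i = j + 1)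
    (hi : ∀ x y : h.Fiber i, ∃ c : ℝ≥0 → h.Fiber i, IsGeodesicSegment c x y)
    (hj : ∀ x y : h.Fiber j, ∃ c : ℝ≥0 → h.Fiber j, IsGeodesicSegment c x y)
    {g : h.Fiber i → h.Fiber j} (hg : ∀ x, dist x.val (g x).val ≤ 2) :
    QuasiEmbedding (f 5 + 2 * f 4) g := by
  obtain ⟨ψ, hψ⟩ := h.exists_fiber_map hij.symm
  have key : ∀ {i j : ℕ} {g : h.Fiber i → h.Fiber j}, (∀ x, dist x.val (g x).val ≤ 2) →
      ∀ x y, dist x y ≤ 1 → dist (g x) (g y) ≤ f 5 := by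
    intro i j g hg x y hxy
    refine h.fiber_dist_le ?_
    push_cast
    have h1 := h.dist_val_le x y
    have h2 := hg x
    rw [dist_comm] at h2
    linarith [dist_triangle4 (g x).val x.val y.val (g y).val, hg y]
  intro x y
  have h0 : (0 : ℝ) ≤ f 4 := Nat.cast_nonneg _
  constructor
  · obtain ⟨c, hc⟩ := hi x y
    have h1 := dist_map_le_of_geodesic (key hg) hc
    have h2 : 0 ≤ 2 * (f 4 : ℝ) * dist x y := by positivity
    linarith
  · obtain ⟨c, hc⟩ := hj (g x) (g y)
    have h1 := dist_map_le_of_geodesic (key hψ) hc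
    have h2 : 0 ≤ 2 * (f 4 : ℝ) * dist (g x) (g y) := by positivity
    have h3 : ∀ z, dist z (ψ (g z)) ≤ f 4 := fun z => by
      refine h.fiber_dist_le ?_
      push_cast
      linarith [dist_triangle z.val (g z).val (ψ (g z)).val, hg z, hψ (g z)]
    have h4 := h3 y
    rw [dist_comm] at h4
    linarith [dist_triangle4 x (ψ (g x)) (ψ (g y)) y, h3 x]

include h in
-- Only finitely many fibers meet the ball, and in each of them the vertices are `1`-separated in a
-- bounded set of a proper space.
theorem finite_vert_ball (hproper : ∀ i, ProperSpace (h.Fiber i)) (p : X) (R : ℝ) :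
    {v | v ∈ G.vert ∧ dist p v ≤ R}.Finite := by
  obtain ⟨N, hN⟩ := exists_nat_ge (π p + R)
  have hfib : ∀ i : ℕ, {v : h.Fiber i | v.val ∈ G.vert ∧ dist p v.val ≤ R}.Finite := by
    intro i
    have := hproper i
    rcases Set.eq_empty_or_nonempty {v : h.Fiber i | v.val ∈ G.vert ∧ dist p v.val ≤ R} with
      he | ⟨w, hw⟩
    · rw [he]
      exact Set.finite_empty
    · refine Set.Finite.of_one_le_dist (y := w) (R := f ⌈2 * R⌉₊) (fun v hv => ?_)
        fun a ha b hb hab => ?_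
      · refine h.fiber_dist_le ((dist_triangle_left v.val w.val p).trans (le_trans ?_ (Nat.le_ceil _)))
        linarith [hv.2, hw.2]
      · refine (h.isMetricGraph.one_le_dist ha.1 hb.1 fun he => hab ?_).trans (h.dist_val_le a b)
        cases a
        cases b
        congr
  refine ((Set.finite_Iic N).biUnion (t := fun i => Fiber.val ''
    {v : h.Fiber i | v.val ∈ G.vert ∧ dist p v.val ≤ R}) fun i _ => (hfib i).image _).subset ?_
  rintro v ⟨hv, hd⟩
  obtain ⟨i, hi⟩ := h.map_vert v hv
  refine Set.mem_biUnion (x := i) ?_ ⟨⟨v, hi⟩, ⟨hv, hd⟩, rfl⟩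
  have h1 := h.dist_proj_le p v
  rw [hi, NNReal.coe_natCast] at h1
  have h2 := neg_le_of_abs_le h1
  have : (i : ℝ) ≤ N := by linarith
  exact_mod_cast this

include h in
theorem hasCompactGeodesics_vert (hproper : ∀ i, ProperSpace (h.Fiber i))
    (hgeo : ∀ x y : X, ∃ c : ℝ≥0 → X, IsGeodesicSegment c x y) : HasCompactGeodesics G.vert := by
  intro p
  obtain ⟨ρ, hρ, hp, hv, hC⟩ := h.isMetricGraph.exists_retraction p (h.finite_vert_ball hproper p)
  choose c hc using hgeo p
  have hseg : ∀ v ∈ G.vert, IsGeodesicSegment (ρ ∘ c v) p v := fun v hvv => by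
    have := (hc v).map_of_lipschitz hρ (by rw [hp, hv v hvv])
    rwa [hp, hv v hvv] at this
  refine ⟨fun v => ρ ∘ c v, hseg, fun s => ?_⟩
  obtain ⟨C, hC, hmem⟩ := hC s
  refine ⟨C, hC, fun v hvv => hmem _ ?_⟩
  rw [← Function.comp_apply (f := ρ), (hseg v hvv).dist_source]
  exact min_le_left _ _

end IsMetricGraphBundle

/-! ### Boundary maps of quasi-isometries -/

theorem IsNear.map {A B X Y : Type*} [MetricSpace X] [MetricSpace Y] {a : ℝ} {φ : X → Y}
    (hφ : QuasiEmbedding a φ) {f : A → X} {g : B → X} (h : IsNear f g) :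
    IsNear (φ ∘ f) (φ ∘ g) := by
  obtain ⟨C, hC⟩ := h
  refine ⟨a * C + a, fun s => ?_⟩
  obtain ⟨t, ht⟩ := hC s
  have : Nonempty X := ⟨f s⟩
  have := hφ.nonneg
  refine ⟨t, (hφ (f s) (g t)).1.trans ?_⟩
  gcongr

theorem IsNear.of_map {A B X Y : Type*} [MetricSpace X] [MetricSpace Y] {a : ℝ} {φ : X → Y}
    (hφ : QuasiEmbedding a φ) {f : A → X} {g : B → X} (h : IsNear (φ ∘ f) (φ ∘ g)) :
    IsNear f g := by
  obtain ⟨C, hC⟩ := h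
  refine ⟨a * C + a, fun s => ?_⟩
  obtain ⟨t, ht⟩ := hC s
  have : Nonempty X := ⟨f s⟩
  have := hφ.nonneg
  refine ⟨t, (hφ (f s) (g t)).2.trans ?_⟩
  gcongr
  exact ht

section BoundaryMaps

variable {X Y : Type u} [MetricSpace X] [MetricSpace Y] {δ A B C : ℝ} {φ : X → Y} {ψ : Y → X}

theorem exists_boundaryMapsTo [ProperSpace Y] (hY : GromovHyperbolic δ Y)
    (hφ : QuasiEmbedding A φ) (ξ : BoundaryTriple X) :
    ∃ ξ' : BoundaryTriple Y, ∀ a, BoundaryMapsTo φ (ξ.1 a) (ξ'.1 a) := by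
  obtain ⟨α, hα⟩ := ξ.exists_rays
  have hφα : ∀ a, QuasiEmbedding A (φ ∘ (α a).1) := fun a => hφ.comp_isometry (α a).2
  obtain ⟨M, -, hM⟩ := exists_ray_isNear.{u} hY.nonneg (hφα 0).nonneg
  have : ∀ a, ∃ β : GeodesicRay Y, IsNear (φ ∘ (α a).1) β.1 := fun a => by
    obtain ⟨β, -, hβ⟩ := hM Y hY Set.univ hY.hasCompactGeodesics_univ
      (fun x => ⟨x, trivial, by simp⟩) _ (hφα a) (φ ((α a).1 0))
    exact ⟨β, _, hβ⟩
  choose β hβ using this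
  refine ⟨⟨fun a => (β a).endpoint, fun a b hab => ?_⟩,
    fun a => ⟨α a, hα a, (hφα a).endsAt_endpoint (hβ a)⟩⟩
  have h1 := (hβ a).trans (GeodesicRay.endpoint_eq_iff.1 hab)
  have h2 := h1.trans ((hφα b).isNear_symm (β b).quasiEmbedding (hβ b))
  have h3 := GeodesicRay.endpoint_eq_iff.2 (h2.of_map hφ)
  rw [hα, hα] at h3
  exact ξ.2 h3

/-- Used to move triangles downwards, so that the upward maps still match them. -/
theorem exists_boundaryMapsTo_of_inverse [ProperSpace X] (hX : GromovHyperbolic δ X)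
    (hφ : QuasiEmbedding A φ) (hψ : QuasiEmbedding B ψ) (h : ∀ y, dist (φ (ψ y)) y ≤ C)
    (ξ' : BoundaryTriple Y) :
    ∃ ξ : BoundaryTriple X, ∀ a, BoundaryMapsTo φ (ξ.1 a) (ξ'.1 a) := by
  obtain ⟨ξ, hξ⟩ := exists_boundaryMapsTo hX hψ ξ'
  refine ⟨ξ, fun a => ?_⟩
  obtain ⟨α, hα, hend⟩ := hξ a
  obtain ⟨β, hβ⟩ := (ξ.1 a).exists_ray
  refine ⟨β, hβ, ?_⟩
  rw [← hα]
  rw [← hβ] at hend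
  refine (hφ.comp_isometry β.2).endsAt_endpoint ((hend.isNear_symm.map hφ).trans ?_)
  exact ⟨C, fun t => ⟨t, h _⟩⟩

theorem BoundaryMapsTo.isNear {α : GeodesicRay X} {β : GeodesicRay Y} (hφ : QuasiEmbedding A φ)
    (h : BoundaryMapsTo φ α.endpoint β.endpoint) : IsNear (φ ∘ α.1) β.1 := by
  obtain ⟨γ, hγ, hend⟩ := h
  exact ((GeodesicRay.endpoint_eq_iff.1 hγ.symm).map hφ).trans hend.isNear

end BoundaryMaps

/-- Recursion extends upwards from index `i`; induction on `i`, shifting the family, extends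
downwards. -/
theorem exists_seq_of_up_down (i : ℕ) : ∀ (T : ℕ → Type u) (R : ∀ i, T i → T (i + 1) → Prop),
    (∀ i x, ∃ y, R i x y) → (∀ i y, ∃ x, R i x y) → ∀ x : T i,
      ∃ s : ∀ j, T j, s i = x ∧ ∀ j, R j (s j) (s (j + 1)) := by
  induction i with
  | zero =>
    intro T R up _ x
    choose g hg using up
    exact ⟨fun j => Nat.rec x (fun k y => g k y) j, rfl, fun j => hg _ _⟩
  | succ i ih =>
    intro T R up down x
    obtain ⟨s, hs, hR⟩ := ih (fun j => T (j + 1)) (fun j => R (j + 1)) (fun j => up (j + 1))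
      (fun j => down (j + 1)) x
    obtain ⟨y, hy⟩ := down 0 (s 0)
    refine ⟨fun j => Nat.casesOn j y s, hs, fun j => ?_⟩
    cases j with
    | zero => exact hy
    | succ j => exact hR j

/-! ### Flows of tripods in the fibers -/

namespace IsMetricGraphBundle

variable {X : Type u} [MetricSpace X] {G : GraphStructure.{u, v} X} {f : ℕ → ℕ} {π : X → ℝ≥0}

/-- Tripods in all fibers, with legs `r i a` from `z i`, such that consecutive ones are close to
each other in `X`. -/
structure TripodFlow (h : IsMetricGraphBundle G f π) (D C : ℝ) where
  /-- the center of the tripod in the fiber over `i` -/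
  z : ∀ i, h.Fiber i
  /-- the legs of the tripod in the fiber over `i` -/
  r : ∀ i, Fin 3 → ℝ≥0 → h.Fiber i
  isometry : ∀ i a, Isometry (r i a)
  source : ∀ i a, r i a 0 = z i
  tripod : ∀ i a b, a ≠ b → ∀ s t, gromovProd (z i) (r i a s) (r i b t) ≤ D
  step : ∀ i, dist (z i).val (z (i + 1)).val ≤ C
  push : ∀ i a s, ∃ t, dist (r i a s).val (r (i + 1) a t).val ≤ C

/-- The triangle with barycenter near `x` is transported to all fibers, and in each fiber a tripod
is drawn from a center. Quasi-isometries coarsely preserve centers and the legs are determined by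
their ends up to bounded distance, so consecutive tripods are close. -/
theorem exists_tripodFlow {δ : ℝ} (hδ : 0 ≤ δ) (f : ℕ → ℕ) :
    ∃ D C : ℝ, 0 ≤ D ∧ 0 ≤ C ∧
      ∀ (X : Type u) [MetricSpace X] (G : GraphStructure.{u, v} X) (π : X → ℝ≥0)
        (h : IsMetricGraphBundle G f π) (L : ℝ),
        h.HasControlledHyperbolicFibers δ L → (∀ i, ProperSpace (h.Fiber i)) →
          ∃ L' : ℝ, ∀ i (x : h.Fiber i), ∃ F : h.TripodFlow D C, dist x (F.z i) ≤ L' := by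
  set d := 3 * δ + 2 with hd
  have hd0 : 0 ≤ d := by positivity
  set A : ℝ := f 5 + 2 * f 4 with hA
  have hA0 : 0 ≤ A := by positivity
  obtain ⟨M, hM0, hM⟩ := exists_isCenter_map.{u} hd0 hA0 (show 0 ≤ 5 * d by positivity)
  obtain ⟨M', hM'0, hM'⟩ := exists_dist_ray_le_of_isNear.{u} hd0 hA0
  -- The bracket bounds the distance from the image of a center to the next center, `M'` is the
  -- further drift along a leg, and `2` is the distance in `X` between a point and its image.
  set C := M' + (5 * d + 2 * M + 2 * d) + 2 with hC
  refine ⟨5 * d, C, by positivity, by positivity, fun X _ G π h L ⟨hhyp, D, hbary⟩ hproper => ?_⟩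
  have hG : ∀ i, GromovHyperbolic d (h.Fiber i) := fun i => (hhyp i).gromovHyperbolic hδ
  choose φ hφ using fun i : ℕ => h.exists_fiber_map (i := i) (j := i + 1) (.inl rfl)
  choose ψ hψ using fun i : ℕ => h.exists_fiber_map (i := i + 1) (j := i) (.inr rfl)
  have hφA : ∀ i, QuasiEmbedding A (φ i) := fun i =>
    h.quasiEmbedding_fiber_map (.inl rfl) (hG i).geodesic (hG (i + 1)).geodesic (hφ i)
  have hψA : ∀ i, QuasiEmbedding A (ψ i) := fun i =>
    h.quasiEmbedding_fiber_map (.inr rfl) (hG (i + 1)).geodesic (hG i).geodesic (hψ i)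
  refine ⟨L + (5 * d + 2 * (D + 2 * d) + 2 * d), fun i x => ?_⟩
  obtain ⟨bary, hbar, hcs⟩ := hbary i
  obtain ⟨ξ₀, hξ₀⟩ := hcs x
  obtain ⟨ξ, hξi, hξ⟩ := exists_seq_of_up_down i (fun j => BoundaryTriple (h.Fiber j))
    (fun j η η' => ∀ a, BoundaryMapsTo (φ j) (η.1 a) (η'.1 a))
    (fun j η => exists_boundaryMapsTo (hG (j + 1)) (hφA j) η)
    (fun j η' => exists_boundaryMapsTo_of_inverse (hG j) (hφA j) (hψA j) (C := f 4) (fun y => by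
      refine h.fiber_dist_le ?_
      push_cast
      have h1 := hφ j (ψ j y)
      have h2 := hψ j y
      rw [dist_comm] at h1 h2
      linarith [dist_triangle (φ j (ψ j y)).val (ψ j y).val y.val]) η') ξ₀
  choose z hz using fun j => (hG j).exists_isCenter (ξ j)
  choose r hr0 hrξ hrD using fun j => (hz j).exists_tripod (hG j)
  have hstep : ∀ j, dist (φ j (z j)) (z (j + 1)) ≤ 5 * d + 2 * M + 2 * d := fun j =>
    (hM _ _ (hG j) (hG (j + 1)) (φ j) (hφA j) _ _ _ (hz j) (hξ j)).dist_le (hG (j + 1))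
      (hz (j + 1))
  refine ⟨⟨z, fun j a => (r j a).1, fun j a => (r j a).2, hr0, hrD, fun j => ?_,
    fun j a s => ?_⟩, ?_⟩
  · have h1 := hφ j (z j)
    have h2 := h.dist_val_le (φ j (z j)) (z (j + 1))
    linarith [dist_triangle (z j).val (φ j (z j)).val (z (j + 1)).val, hstep j]
  · have hn : IsNear (φ j ∘ (r j a).1) (r (j + 1) a).1 := by
      refine BoundaryMapsTo.isNear (hφA j) ?_
      rw [hrξ, hrξ]
      exact hξ j a
    obtain ⟨t, ht⟩ := hM' _ (hG (j + 1)) _ ((hφA j).comp_isometry (r j a).2) _ hn s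
    refine ⟨t, ?_⟩
    simp only [Function.comp_apply, hr0] at ht
    have h1 := hφ j ((r j a).1 s)
    have h2 := h.dist_val_le (φ j ((r j a).1 s)) ((r (j + 1) a).1 t)
    linarith [dist_triangle ((r j a).1 s).val (φ j ((r j a).1 s)).val ((r (j + 1) a).1 t).val,
      hstep j]
  · have h1 : IsCenter (D + 2 * d) (bary ξ₀) (ξ i) := by
      rw [hξi]
      exact (hbar ξ₀).isCenter (hG i)
    have h2 := h1.dist_le (hG i) (hz i)
    change dist x (z i) ≤ _
    linarith [dist_triangle x (bary ξ₀) (z i)]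

theorem Fiber.ext_val {h : IsMetricGraphBundle G f π} {i : ℕ} {x y : h.Fiber i}
    (hxy : x.val = y.val) : x = y := by
  cases x
  cases y
  congr

theorem tendsto_val {ι : Type*} {l : Filter ι} {h : IsMetricGraphBundle G f π} {i : ℕ}
    {x : ι → h.Fiber i} {y : h.Fiber i} (hx : Tendsto x l (𝓝 y)) :
    Tendsto (fun n => (x n).val) l (𝓝 y.val) :=
  ((LipschitzWith.of_dist_le_mul (K := 1) (f := fun x : h.Fiber i => x.val) fun a b => by
    simpa using h.dist_val_le a b).continuous.tendsto y).comp hx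

namespace TripodFlow

variable {h : IsMetricGraphBundle G f π} {D C : ℝ} (F : h.TripodFlow D C)

theorem dist_le {i j : ℕ} (hij : i ≤ j) :
    dist (F.z i).val (F.z j).val ≤ C * ((j : ℝ) - i) := by
  have h1 := dist_le_Ico_sum_of_dist_le (f := fun i => (F.z i).val) hij (d := fun _ => C)
    fun {k} _ _ => F.step k
  rw [Finset.sum_const, Nat.card_Ico, nsmul_eq_mul, Nat.cast_sub hij] at h1
  linarith

/-- The centers of the tripods, as a section of the bundle. -/
noncomputable def toSection (s : ℝ≥0) : X := (F.z ⌊s⌋₊).val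

theorem toSection_natCast (i : ℕ) : F.toSection i = (F.z i).val :=
  congrArg (fun j => (F.z j).val) (Nat.floor_natCast i)

theorem isQISection {K : ℝ} (hK : 1 ≤ K) (hC : C ≤ K) : IsQISection π K F.toSection := by
  have hup : ∀ s t, s ≤ t → dist (F.toSection s) (F.toSection t) ≤ K * dist s t + K := by
    intro s t hst
    -- The upper bound sums the steps of the flow; the lower bound `hlow` holds for any section
    -- since `π` is `1`-Lipschitz.
    have h1 := F.dist_le (Nat.floor_mono hst)
    have h2 : (⌊t⌋₊ : ℝ) ≤ t := Nat.floor_le t.2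
    have h3 : (s : ℝ) < ⌊s⌋₊ + 1 := Nat.lt_floor_add_one s
    have h4 : (⌊s⌋₊ : ℝ) ≤ ⌊t⌋₊ := by exact_mod_cast Nat.floor_mono hst
    have h5 : (s : ℝ) ≤ t := hst
    rw [NNReal.dist_eq, abs_of_nonpos (by linarith)]
    have h6 : C * ((⌊t⌋₊ : ℝ) - ⌊s⌋₊) ≤ K * ((⌊t⌋₊ : ℝ) - ⌊s⌋₊) :=
      mul_le_mul_of_nonneg_right hC (by linarith)
    have h7 : K * ((⌊t⌋₊ : ℝ) - ⌊s⌋₊) ≤ K * (t - s + 1) := by gcongr; linarith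
    unfold toSection
    linarith
  have hlow : ∀ s t, s ≤ t → dist s t ≤ dist (F.toSection s) (F.toSection t) + 1 := by
    intro s t hst
    have h1 := h.dist_proj_le (F.toSection t) (F.toSection s)
    have h2 : (⌊s⌋₊ : ℝ) ≤ s := Nat.floor_le s.2
    have h3 : (t : ℝ) < ⌊t⌋₊ + 1 := Nat.lt_floor_add_one t
    have h5 : (s : ℝ) ≤ t := hst
    have e1 : π (F.toSection t) = ⌊t⌋₊ := (F.z _).mem
    have e2 : π (F.toSection s) = ⌊s⌋₊ := (F.z _).mem
    rw [e1, e2, NNReal.coe_natCast, NNReal.coe_natCast, dist_comm] at h1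
    rw [NNReal.dist_eq, abs_of_nonpos (by linarith)]
    linarith [(le_abs_self _).trans h1]
  have hdiv : ∀ a b : ℝ, 0 ≤ a → a ≤ b + 1 → a / K - K ≤ b := fun a b ha hab => by
    have := div_le_self ha hK
    linarith
  refine ⟨fun s t => ?_, fun i => ?_⟩
  · rcases le_total s t with hst | hst
    · exact ⟨hdiv _ _ dist_nonneg (hlow s t hst), hup s t hst⟩
    · rw [dist_comm s, dist_comm (F.toSection s)]
      exact ⟨hdiv _ _ dist_nonneg (hlow t s hst), hup t s hst⟩
  · rw [F.toSection_natCast]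
    exact (F.z i).mem

/-- The legs of the tripods, as geodesic rays. -/
noncomputable def ray (i : ℕ) (a : Fin 3) : GeodesicRay (h.Fiber i) := ⟨F.r i a, F.isometry i a⟩

theorem ray_zero (i : ℕ) (a : Fin 3) : (F.ray i a).1 0 = F.z i := F.source i a

/-- The end points of the legs. -/
noncomputable def triple (i : ℕ) : BoundaryTriple (h.Fiber i) :=
  ⟨fun a => (F.ray i a).endpoint, fun a b hab => by
    -- Legs staying close would have unbounded products at the center, against `tripod`.
    by_contra hne
    obtain ⟨E, hE⟩ := GeodesicRay.endpoint_eq_iff.1 hab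
    obtain ⟨s, hs⟩ := exists_nat_gt (E + 2 * D)
    obtain ⟨t, ht⟩ := hE s
    have h1 := F.tripod i a b hne s t
    have h2 := (F.ray i a).dist_zero s
    have h3 := (F.ray i b).dist_zero t
    rw [ray_zero] at h2 h3
    change dist (F.z i) (F.r i a s) = _ at h2
    change dist (F.z i) (F.r i b t) = _ at h3
    change dist (F.r i a s) (F.r i b t) ≤ E at ht
    unfold gromovProd at h1
    rw [h2, h3, NNReal.coe_natCast] at h1
    linarith [t.coe_nonneg]⟩

/-- A flow does not refer to `φ`: closeness of consecutive legs in `X` becomes closeness in the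
fiber through `f`, so any maps moving points by at most `2` match the ends. The constant is `2 * d`
for changing rays plus `4 * d` from center to barycenter. -/
theorem isGoodQISection {d A K : ℝ} (hG : ∀ i, GromovHyperbolic d (h.Fiber i))
    {φ : ∀ i, h.Fiber i → h.Fiber (i + 1)} (hφ : ∀ i x, dist x.val (φ i x).val ≤ 2)
    (hφA : ∀ i, QuasiEmbedding A (φ i)) (hK : 1 ≤ K) (hC : C ≤ K) (hD : D + 6 * d ≤ K) :
    h.IsGoodQISection φ K F.toSection := by
  have hd := (hG 0).nonneg
  refine ⟨F.isQISection hK hC, F.triple, fun i => ?_, fun i j => ?_⟩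
  · have h1 : IsCenter (D + 2 * d) (F.z i) (F.triple i) :=
      isCenter_of_rays (hG i) (α := F.ray i) (fun a => rfl) fun a b hab =>
        ⟨0, fun s _ t _ => F.tripod i a b hab s t⟩
    have h2 : (⟨F.toSection i, (F.isQISection hK hC).map_nat i⟩ : h.Fiber i) = F.z i :=
      Fiber.ext_val (F.toSection_natCast i)
    rw [h2]
    intro a b hab β hβ
    obtain ⟨t, ht⟩ := h1.isBarycenter (hG i) a b hab β hβ
    exact ⟨t, by linarith⟩
  · refine ⟨F.ray i j, rfl, ((hφA i).comp_isometry (F.isometry i j)).endsAt_endpoint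
      (α := F.ray (i + 1) j) ⟨f ⌈C + 2⌉₊, fun s => ?_⟩⟩
    obtain ⟨t, ht⟩ := F.push i j s
    refine ⟨t, h.fiber_dist_le (le_trans ?_ (Nat.le_ceil _))⟩
    have h1 := hφ i (F.r i j s)
    rw [dist_comm] at h1
    change dist (φ i (F.r i j s)).val (F.r (i + 1) j t).val ≤ _
    linarith [dist_triangle (φ i (F.r i j s)).val (F.r i j s).val (F.r (i + 1) j t).val]

/-- Bounded steps spread boundedness of the centers from the fiber over `0` to all fibers. The legs
then converge by properness, and all conditions are closed. -/
theorem exists_limit (hproper : ∀ i, ProperSpace (h.Fiber i)) (U : Ultrafilter ℕ)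
    (F : ℕ → h.TripodFlow D C) {p : X} {R : ℝ}
    (hR : ∀ᶠ n in (U : Filter ℕ), dist p ((F n).z 0).val ≤ R) :
    ∃ F' : h.TripodFlow D C, ∀ i, Tendsto (fun n => (F n).z i) U (𝓝 (F'.z i)) := by
  have hball : ∀ i, ∃ (w : h.Fiber i) (S : ℝ), ∀ᶠ n in (U : Filter ℕ),
      dist w ((F n).z i) ≤ S := by
    intro i
    obtain ⟨w⟩ := h.nonempty_fiber i
    refine ⟨w, f ⌈dist w.val p + R + C * ((i : ℝ) - (0 : ℕ))⌉₊, ?_⟩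
    filter_upwards [hR] with n hn
    refine h.fiber_dist_le (le_trans ?_ (Nat.le_ceil _))
    have := (F n).dist_le (Nat.zero_le i)
    linarith [dist_triangle4 w.val p ((F n).z 0).val ((F n).z i).val]
  choose w S hS using hball
  have hdz : ∀ n i a s, dist ((F n).z i) ((F n).r i a s) = s := fun n i a s => by
    have := ((F n).ray i a).dist_zero s
    rwa [ray_zero] at this
  have hlim : ∀ i a, ∃ α : ℝ≥0 → h.Fiber i, Isometry α ∧
      ∀ s, Tendsto (fun n => (F n).r i a s) U (𝓝 (α s)) := fun i a =>
    have := hproper i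
    U.exists_isometry_tendsto (c := fun n => (F n).r i a)
      (fun s => ⟨_, isCompact_closedBall (w i) (S i + s), by
        filter_upwards [hS i] with n hn
        rw [Metric.mem_closedBall, dist_comm]
        linarith [dist_triangle (w i) ((F n).z i) ((F n).r i a s), hdz n i a s]⟩)
      (fun s t => Eventually.of_forall fun n => ((F n).isometry i a).dist_eq s t)
  choose r hr hrlim using hlim
  have hz : ∀ i a, Tendsto (fun n => (F n).z i) U (𝓝 (r i a 0)) := fun i a => by
    simpa only [(F _).source] using hrlim i a 0
  refine ⟨⟨fun i => r i 0 0, r, hr, fun i a => tendsto_nhds_unique (hz i a) (hz i 0), ?_, ?_, ?_⟩,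
    fun i => hz i 0⟩
  · intro i a b hab s t
    refine le_of_tendsto ((((hz i 0).dist (hrlim i a s)).add ((hz i 0).dist (hrlim i b t))).sub
      ((hrlim i a s).dist (hrlim i b t)) |>.div_const 2) (Eventually.of_forall fun n => ?_)
    exact (F n).tripod i a b hab s t
  · intro i
    exact le_of_tendsto ((tendsto_val (hz i 0)).dist (tendsto_val (hz (i + 1) 0)))
      (Eventually.of_forall fun n => (F n).step i)
  · intro i a s
    choose t ht using fun n => (F n).push i a s
    -- Bounds the partner times `t n` in `push`: the partner point is within `C + s + C` of its
    -- center in `X`, and its time is its distance from the center in the fiber.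
    set T : ℝ≥0 := (f ⌈C + s + C⌉₊ : ℝ≥0) with hT
    have htT : ∀ n, t n ≤ T := fun n => by
      have h1 : dist ((F n).z (i + 1)) ((F n).r (i + 1) a (t n)) ≤ f ⌈C + s + C⌉₊ := by
        refine h.fiber_dist_le (le_trans ?_ (Nat.le_ceil _))
        have h2 := (F n).step i
        have h3 := h.dist_val_le ((F n).z i) ((F n).r i a s)
        have h4 := dist_triangle4 ((F n).z (i + 1)).val ((F n).z i).val ((F n).r i a s).val
          ((F n).r (i + 1) a (t n)).val
        rw [dist_comm] at h2
        rw [hdz] at h3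
        linarith [ht n]
      rw [hdz] at h1
      exact_mod_cast h1
    obtain ⟨t', -, ht'⟩ := U.exists_tendsto_of_isCompact (isCompact_Icc (a := 0) (b := T))
      (Eventually.of_forall fun n => ⟨zero_le, htT n⟩)
    refine ⟨t', ?_⟩
    have h1 : Tendsto (fun n => (F n).r (i + 1) a (t n)) U (𝓝 (r (i + 1) a t')) := by
      rw [tendsto_iff_dist_tendsto_zero]
      have h2 := (tendsto_iff_dist_tendsto_zero.1 ht').add
        (tendsto_iff_dist_tendsto_zero.1 (hrlim (i + 1) a t'))
      rw [add_zero] at h2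
      refine squeeze_zero (fun _ => dist_nonneg) (fun n => ?_) h2
      rw [← ((F n).isometry (i + 1) a).dist_eq (t n) t']
      exact dist_triangle _ _ _
    exact le_of_tendsto ((tendsto_val (hrlim i a s)).dist (tendsto_val h1))
      (Eventually.of_forall ht)

end TripodFlow

end IsMetricGraphBundle

/-! ### Endpoints of qi sections, and the two cases for flows along a ray -/

theorem IsQIEmbedding.quasiEmbedding {X Y : Type*} [MetricSpace X] [MetricSpace Y] {K : ℝ}
    {g : Y → X} (hg : IsQIEmbedding K g) (hK : 1 ≤ K) : QuasiEmbedding (K * K) g := by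
  intro y y'
  obtain ⟨h1, h2⟩ := hg y y'
  have hKK : K ≤ K * K := le_mul_of_one_le_left (by linarith) hK
  constructor
  · refine h2.trans ?_
    gcongr
  · rw [sub_le_iff_le_add, div_le_iff₀ (by linarith)] at h1
    have : K * dist (g y) (g y') ≤ K * K * dist (g y) (g y') := by gcongr
    linarith

namespace IsMetricGraphBundle

variable {X : Type u} [MetricSpace X] {G : GraphStructure.{u, v} X} {f : ℕ → ℕ} {π : X → ℝ≥0}
  {h : IsMetricGraphBundle G f π} {D C K δ : ℝ}

theorem IsQISection.existsUnique_endsAt (h : IsMetricGraphBundle G f π)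
    (hX : GromovHyperbolic δ X) (hproper : ∀ i, ProperSpace (h.Fiber i)) (hK : 1 ≤ K)
    {σ : ℝ≥0 → X} (hσ : IsQISection π K σ) : ∃! ξ, EndsAt σ ξ := by
  have hσ' := hσ.qi.quasiEmbedding hK
  obtain ⟨M, -, hM⟩ := exists_ray_isNear.{u} hX.nonneg hσ'.nonneg
  obtain ⟨α, -, hα⟩ := hM X hX G.vert (h.hasCompactGeodesics_vert hproper hX.geodesic)
    h.isMetricGraph.exists_vert_dist_le σ hσ' (σ 0)
  exact ⟨α.endpoint, hσ'.endsAt_endpoint ⟨_, hα⟩, fun η hη =>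
    hη.unique (hσ'.endsAt_endpoint ⟨_, hα⟩)⟩

theorem TripodFlow.isQuasiGeodesicSeq (F : h.TripodFlow D C) (hK : 1 ≤ K) (hC : C ≤ K) (n : ℕ) :
    IsQuasiGeodesicSeq K (fun i => (F.z i).val) n := by
  refine ⟨fun i _ => (F.step i).trans hC, fun i j _ _ => ?_⟩
  have h1 := (le_abs_self _).trans (h.dist_proj_le (F.z j).val (F.z i).val)
  rw [(F.z j).mem, (F.z i).mem, NNReal.coe_natCast, NNReal.coe_natCast, dist_comm] at h1
  have h2 : 1 * dist (F.z i).val (F.z j).val ≤ K * dist (F.z i).val (F.z j).val := by gcongr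
  linarith

/-- If flows through points near a geodesic ray meet a bounded part of the fiber over `0`
infinitely often, then a limit flow ends at the end point of the ray. -/
theorem exists_tripodFlow_endsAt (hX : GromovHyperbolic δ X)
    (hproper : ∀ i, ProperSpace (h.Fiber i)) (hK : 1 ≤ K) (hC0 : 0 ≤ C) (hC : C ≤ K)
    {α : GeodesicRay X} {F : ℕ → h.TripodFlow D C} {i : ℕ → ℕ} {E : ℝ}
    (hF : ∀ n : ℕ, dist (α.1 n) ((F n).z (i n)).val ≤ E) {R : ℝ}
    (hR : ∃ᶠ n in atTop, dist (α.1 0) ((F n).z 0).val ≤ R) :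
    ∃ F' : h.TripodFlow D C, EndsAt F'.toSection α.endpoint := by
  obtain ⟨M, -, hM⟩ := exists_gromovProd_quasiGeodesicSeq_le.{u} hX.nonneg
    (show 0 ≤ K by linarith)
  have hne := frequently_iff_neBot.1 hR
  -- The limit is taken along indices whose flows start in the bounded set.
  let U := Ultrafilter.of (atTop ⊓ 𝓟 {n | dist (α.1 0) ((F n).z 0).val ≤ R})
  have hU : (U : Filter ℕ) ≤ atTop := (Ultrafilter.of_le _).trans inf_le_left
  have hUR : ∀ᶠ n in (U : Filter ℕ), dist (α.1 0) ((F n).z 0).val ≤ R :=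
    (Ultrafilter.of_le _).trans inf_le_right (mem_principal_self _)
  obtain ⟨F', hF'⟩ := TripodFlow.exists_limit hproper U F hUR
  refine ⟨F', ((F'.isQISection hK hC).qi.quasiEmbedding hK).endsAt_endpoint
    ⟨1 + (M + R + E + 2 * δ), fun s => ?_⟩⟩
  set T := ⌊s⌋₊ with hT
  have hlarge : ∀ᶠ n : ℕ in atTop, R + C * T + E < n :=
    tendsto_natCast_atTop_atTop.eventually_gt_atTop _
  obtain ⟨n, ⟨hn1, hn2⟩, hn3⟩ := (((Metric.tendsto_nhds.1 (hF' T) 1 one_pos).and hUR).and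
    (hU hlarge)).exists
  -- Once `n` is large, the flow needs more than `T` steps to get near `α.1 n`. Hence its center
  -- over `T` lies on a quasigeodesic with ends near `α.1 0` and `α.1 n`, and the Morse lemma
  -- applies.
  have hTi : T ≤ i n := by
    by_contra! hlt
    have h1 := (F n).dist_le (Nat.zero_le (i n))
    have h2 := α.dist_zero n
    have h3 := dist_triangle4 (α.1 0) ((F n).z 0).val ((F n).z (i n)).val (α.1 n)
    have h4 : (i n : ℝ) ≤ T := by exact_mod_cast hlt.le
    have h5 : C * (i n : ℝ) ≤ C * T := by gcongr
    simp only [NNReal.coe_natCast, Nat.cast_zero, sub_zero] at h1 h2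
    linarith [hF n, dist_comm (α.1 n) ((F n).z (i n)).val]
  have h1 := (hM X hX _ _ ((F n).isQuasiGeodesicSeq hK hC (i n))).1 T hTi
  have h2 := gromovProd_le_left ((F n).z T).val (α.1 0) ((F n).z 0).val (α.1 n)
  have h3 := gromovProd_le_right ((F n).z T).val ((F n).z 0).val (α.1 n) ((F n).z (i n)).val
  obtain ⟨t, -, -, ht⟩ := hX.exists_dist_ray_le (w := ((F n).z T).val) (β := α) (t := n)
    (E := M + R + E) (by linarith [hF n])
  refine ⟨t, ?_⟩
  have h4 := h.dist_val_le ((F n).z T) (F'.z T)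
  rw [dist_comm] at h4
  change dist (F'.z T).val (α.1 t) ≤ _
  linarith [dist_triangle (F'.z T).val ((F n).z T).val (α.1 t)]

/-- If flows through points near a geodesic ray leave every bounded part of the fiber over `0`,
then the end point of the ray is a limit point of this fiber. -/
theorem endpoint_mem_limitSet (hX : GromovHyperbolic δ X)
    (hproper : ∀ i, ProperSpace (h.Fiber i)) (hK : 1 ≤ K) (hC0 : 0 ≤ C) (hC : C ≤ K)
    {α : GeodesicRay X} {F : ℕ → h.TripodFlow D C} {i : ℕ → ℕ} {E : ℝ}
    (hF : ∀ n : ℕ, dist (α.1 n) ((F n).z (i n)).val ≤ E)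
    (hR : ∀ R, ∀ᶠ n in atTop, R < dist (α.1 0) ((F n).z 0).val) :
    α.endpoint ∈ limitSet (π ⁻¹' {0}) := by
  obtain ⟨M, -, hM⟩ := exists_gromovProd_quasiGeodesicSeq_le.{u} hX.nonneg
    (show 0 ≤ K by linarith)
  -- Starting points are replaced by vertices because compact families of geodesics are available
  -- only towards vertices.
  choose a hav ha0 ha using fun n => h.exists_vert_fiber ((F n).z 0).mem
  refine ⟨a, fun n => by simpa using ha0 n, hX.convergesToBoundary
    (h.hasCompactGeodesics_vert hproper hX.geodesic) hav ?_⟩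
  rw [tendsto_atTop]
  intro B
  -- If the product of `a n` and `α.1 n` were below `B`, the flow would come within `B'` of `α.1 0`:
  -- `1` and `E` pay for moving the two ends, `M` for the Morse lemma. This happens over some `j ≤ π
  -- (α.1 0) + B'`, so the flow would start too close to `α.1 0`.
  set B' := B + 1 + E + M with hB'
  filter_upwards [hR (C * (π (α.1 0) + B') + B')] with n hn
  by_contra! hlt
  have h1 := gromovProd_le_left (α.1 0) ((F n).z 0).val (a n) ((F n).z (i n)).val
  have h2 := gromovProd_le_right (α.1 0) (a n) ((F n).z (i n)).val (α.1 n)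
  obtain ⟨j, -, hj⟩ := (hM X hX _ _ ((F n).isQuasiGeodesicSeq hK hC (i n))).2 (α.1 0)
  have h3 : dist (α.1 0) ((F n).z j).val ≤ B' := by
    rw [dist_comm _ (α.1 n)] at h2
    linarith [ha n, hF n]
  have h4 := (neg_le_abs _).trans (h.dist_proj_le (α.1 0) ((F n).z j).val)
  rw [((F n).z j).mem, NNReal.coe_natCast] at h4
  have h5 := (F n).dist_le (Nat.zero_le j)
  rw [Nat.cast_zero, sub_zero] at h5
  have h6 : C * (j : ℝ) ≤ C * (π (α.1 0) + B') := by gcongr; linarith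
  linarith [dist_triangle_right (α.1 0) ((F n).z 0).val ((F n).z j).val]

end IsMetricGraphBundle

theorem proposition4p15 (δ : ℝ) (hδ : 0 ≤ δ) (f : ℕ → ℕ) :
    ∃ K : ℝ, 1 ≤ K ∧
      ∀ (X : Type u) [MetricSpace X] (G : GraphStructure.{u, v} X) (π : X → ℝ≥0)
        (h : IsMetricGraphBundle G f π) (L : ℝ),
        h.HasControlledHyperbolicFibers δ L →
        (∀ i, ProperSpace (h.Fiber i)) →
        (∃ δ' : ℝ, IsHyperbolic δ' X) →
        ∀ φ : ∀ i, h.Fiber i → h.Fiber (i + 1), (∀ i, h.IsNaturalMap i (φ i)) →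
          (∀ σ : ℝ≥0 → X, h.IsGoodQISection φ K σ → ∃! ξ, EndsAt σ ξ) ∧
          (Set.univ : Set (GeodesicBoundary X)) =
            limitSet (π ⁻¹' {0}) ∪ h.goodBoundary φ K := by
  obtain ⟨D, C, hD0, hC0, hflow⟩ := IsMetricGraphBundle.exists_tripodFlow.{u, v} hδ f
  set K : ℝ := max 1 (max C (D + 6 * (3 * δ + 2))) with hK'
  have hK : 1 ≤ K := le_max_left _ _
  have hCK : C ≤ K := (le_max_left _ _).trans (le_max_right _ _)
  have hDK : D + 6 * (3 * δ + 2) ≤ K := (le_max_right _ _).trans (le_max_right _ _)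
  refine ⟨K, hK, fun X _ G π h L hfib hproper ⟨δ', hδ'⟩ φ hφ => ?_⟩
  -- The given constant of `X` carries no sign condition; slimness is monotone in it. It does not
  -- enter `K`.
  have hX : GromovHyperbolic (3 * max δ' 0 + 2) X := by
    refine IsHyperbolic.gromovHyperbolic ⟨hδ'.geodesic, ?_⟩ (le_max_right _ _)
    intro x y z c₁ c₂ c₃ h₁ h₂ h₃ p hp
    obtain ⟨q, hq, hd⟩ := hδ'.slim x y z c₁ c₂ c₃ h₁ h₂ h₃ p hp
    exact ⟨q, hq, hd.trans (le_max_left _ _)⟩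
  have hG : ∀ i, GromovHyperbolic (3 * δ + 2) (h.Fiber i) := fun i =>
    (hfib.1 i).gromovHyperbolic hδ
  have hφ2 : ∀ i x, dist x.val (φ i x).val ≤ 2 := fun i x => (hφ i).dist_le x
  have hgood : ∀ F : h.TripodFlow D C, h.IsGoodQISection φ K F.toSection := fun F =>
    F.isGoodQISection hG hφ2 (fun i => h.quasiEmbedding_fiber_map (.inl rfl) (hG i).geodesic
      (hG (i + 1)).geodesic (hφ2 i)) hK hCK hDK
  refine ⟨fun σ hσ => hσ.1.existsUnique_endsAt h hX hproper hK, ?_⟩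
  refine (Set.eq_univ_of_forall fun ξ => ?_).symm
  obtain ⟨α, rfl⟩ := ξ.exists_ray
  obtain ⟨L', hL'⟩ := hflow X G π h L hfib hproper
  have hnear : ∀ n : ℕ, ∃ (i : ℕ) (F : h.TripodFlow D C),
      dist (α.1 n) (F.z i).val ≤ 1 + L' := fun n => by
    obtain ⟨v, hv, hd⟩ := h.isMetricGraph.exists_vert_dist_le (α.1 n)
    obtain ⟨i, hi⟩ := h.map_vert v hv
    obtain ⟨F, hF⟩ := hL' i ⟨v, hi⟩
    have := h.dist_val_le ⟨v, hi⟩ (F.z i)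
    exact ⟨i, F, by linarith [dist_triangle (α.1 n) v (F.z i).val]⟩
  choose i F hF using hnear
  -- The dichotomy: starting points that recur in a bounded set give a good section, escaping ones a
  -- limit point of the fiber over `0`.
  by_cases hR : ∃ R, ∃ᶠ n in atTop, dist (α.1 0) ((F n).z 0).val ≤ R
  · obtain ⟨R, hR⟩ := hR
    obtain ⟨F', hF'⟩ :=
      IsMetricGraphBundle.exists_tripodFlow_endsAt hX hproper hK hC0 hCK hF hR
    exact .inr ⟨_, hgood F', hF'⟩
  · simp only [not_exists, not_frequently, not_le] at hR
    exact .inl (IsMetricGraphBundle.endpoint_mem_limitSet hX hproper hK hC0 hCK hF hR)
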